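/- Let $M$ be a simply connected (in particular, connected and non-empty) finite-dimensional smooth manifold and let $F\to M$ be a smooth real vector bundle of finite rank. Write $\mathfrak X M$ for the space of smooth vector fields on $M$ (the even fields), $\Gamma F$ for the space of smooth sections of $F$ (the odd fields), and $\hat{\mathfrak X}M=\mathfrak X M\oplus\Gamma F$ for the space of sections of $\hat TM = TM\oplus F$. Fields $\mathbf U=U+\alpha\in\hat{\mathfrak X}M$ act on functions $f\in C^\infty(M)$ by $\mathbf U(f)=U(f)$. Suppose that $\hat TM$ is a super tangent bundle, that is, $\hat{\mathfrak X}M$ is equipped with a real super Lie algebra bracket $[\cdot,\cdot]$ with even part $\mathfrak X M$ and odd part $\Gamma F$ (an $\mathbb R$-bilinear, parity-preserving bracket with $[\mathbf x,\mathbf y]=-(-1)^{|\mathbf x||\mathbf y|}[\mathbf y,\mathbf x]$ and $[\mathbf x,[\mathbf y,\mathbf z]]=[[\mathbf x,\mathbf y],\mathbf z]+(-1)^{|\mathbf x||\mathbf y|}[\mathbf y,[\mathbf x,\mathbf z]]$ for homogeneous $\mathbf x,\mathbf y,\mathbf z$), which is the usual Lie bracket of vector fields on $\mathfrak X M$, and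 which satisfies $$[\mathbf U,f\mathbf V]=\mathbf U(f)\,\mathbf V+f\,[\mathbf U,\mathbf V]\qquad(\mathbf U,\mathbf V\in\hat{\mathfrak X}M,\ f\in C^\infty(M)).$$ Theorem. The bundle $F$ is trivial: there are a finite-dimensional real vector space $W$ and a smooth vector bundle isomorphism $\Phi:F\to M\times W$ over the identity of $M$. Moreover, $\Phi$ can be chosen so that, when sections $\alpha$ of $F$ are identified through $\Phi$ with smooth functions $M\to W$, for every vector field $U\in\mathfrak X M$ and every $\alpha\in\Gamma F$ the bracket $[U,\alpha]$ is the odd field $$[U,\alpha]=U(\alpha),$$ where $U(\alpha)$ is the derivative of the $W$-valued function $\alpha$ along $U$. -/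

import Mathlib

open scoped Manifold ContDiff Bundle

/-- The homogeneous parts of the super vector space `V₀ ⊕ V₁`: the even part `V₀ ⊕ 0` in
degree `0` and the odd part `0 ⊕ V₁` in degree `1`. -/
def superPart (V₀ V₁ : Type*) [AddCommGroup V₀] [Module ℝ V₀] [AddCommGroup V₁] [Module ℝ V₁]
    (i : ZMod 2) : Submodule ℝ (V₀ × V₁) :=
  if i = 0 then Submodule.prod ⊤ ⊥ else Submodule.prod ⊥ ⊤

/-- A (real) super Lie algebra structure on the super vector space `V₀ ⊕ V₁`. -/
structure SuperLieStructure (V₀ V₁ : Type*) [AddCommGroup V₀] [Module ℝ V₀]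
    [AddCommGroup V₁] [Module ℝ V₁] where
  /-- the bracket `[x, y]`, an `ℝ`-bilinear map -/
  bracket : (V₀ × V₁) →ₗ[ℝ] (V₀ × V₁) →ₗ[ℝ] (V₀ × V₁)
  /-- the bracket respects parity: `|[x, y]| = |x| + |y|` -/
  bracket_mem : ∀ (i j : ZMod 2) (x y : V₀ × V₁),
    x ∈ superPart V₀ V₁ i → y ∈ superPart V₀ V₁ j → bracket x y ∈ superPart V₀ V₁ (i + j)
  /-- super skew-symmetry: `[x, y] = -(-1)^{|x||y|} [y, x]` -/
  bracket_skew : ∀ (i j : ZMod 2) (x y : V₀ × V₁),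
    x ∈ superPart V₀ V₁ i → y ∈ superPart V₀ V₁ j →
      bracket x y = -((-1 : ℝ) ^ (i.val * j.val) • bracket y x)
  /-- super Jacobi identity: `[x, [y, z]] = [[x, y], z] + (-1)^{|x||y|} [y, [x, z]]` -/
  jacobi : ∀ (i j : ZMod 2) (x y z : V₀ × V₁),
    x ∈ superPart V₀ V₁ i → y ∈ superPart V₀ V₁ j →
      bracket x (bracket y z) =
        bracket (bracket x y) z + (-1 : ℝ) ^ (i.val * j.val) • bracket y (bracket x z)

section SuperTangent

variable (E : Type*) [NormedAddCommGroup E] [NormedSpace ℝ E]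
  (M : Type*) [TopologicalSpace M] [ChartedSpace E M] [IsManifold 𝓘(ℝ, E) ∞ M]

/-- The space `𝔛 M` of smooth (ordinary, even) vector fields on `M`. -/
abbrev EvenField : Type _ := Cₛ^∞⟮𝓘(ℝ, E); E, (TangentSpace 𝓘(ℝ, E) : M → Type _)⟯

variable (W : Type*) [NormedAddCommGroup W] [NormedSpace ℝ W]
  (F : M → Type*) [TopologicalSpace (Bundle.TotalSpace W F)]
  [∀ x, TopologicalSpace (F x)] [FiberBundle W F]

/-- The space `Γ F` of smooth sections of `F` (the odd vector fields). -/
abbrev OddField : Type _ := Cₛ^∞⟮𝓘(ℝ, E); W, F⟯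

variable {E M W F}

/-- The product `f • s` of a smooth function and a smooth section. -/
noncomputable def funSMul [∀ x, AddCommGroup (F x)] [∀ x, Module ℝ (F x)] [VectorBundle ℝ W F]
    (f : C^∞⟮𝓘(ℝ, E), M; ℝ⟯) (s : Cₛ^∞⟮𝓘(ℝ, E); W, F⟯) : Cₛ^∞⟮𝓘(ℝ, E); W, F⟯ :=
  ⟨fun x => f x • s x, ContMDiff.smul_section f.contMDiff s.contMDiff⟩

/-- The action `U(h)` of a vector field `U` on a function `h` with values in a normed space:
`U(h)(x) = dh_x (U x)`. -/
noncomputable def EvenField.act {N : Type*} [NormedAddCommGroup N] [NormedSpace ℝ N]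
    (U : EvenField E M) (h : M → N) (x : M) : N :=
  mvfderiv 𝓘(ℝ, E) h x (U x)

variable (E M W F)

/-- A super tangent bundle structure on `TM ⊕ F`: a super Lie algebra structure on the space of
sections `𝔛 M ⊕ Γ F` of `TM ⊕ F`, whose even Lie algebra is `𝔛 M` with the usual Lie bracket and
which satisfies `[𝐔, f 𝐕] = 𝐔(f) 𝐕 + f [𝐔, 𝐕]`. Here `(U + α)(f) = U(f)`, since odd fields act
by zero on functions. -/
structure SuperTangentBundle [∀ x, AddCommGroup (F x)] [∀ x, Module ℝ (F x)]
    [VectorBundle ℝ W F] extends SuperLieStructure (EvenField E M) (OddField E M W F) where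
  bracket_even : ∀ (U V : EvenField E M) (x : M),
    (bracket (U, 0) (V, 0)).1 x = VectorField.mlieBracket 𝓘(ℝ, E) (fun y => U y) (fun y => V y) x
  leibniz_even : ∀ (X Y : EvenField E M × OddField E M W F) (f : C^∞⟮𝓘(ℝ, E), M; ℝ⟯) (x : M),
    (bracket X (funSMul f Y.1, funSMul f Y.2)).1 x =
      X.1.act f x • Y.1 x + f x • (bracket X Y).1 x
  leibniz_odd : ∀ (X Y : EvenField E M × OddField E M W F) (f : C^∞⟮𝓘(ℝ, E), M; ℝ⟯) (x : M),
    (bracket X (funSMul f Y.1, funSMul f Y.2)).2 x =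
      X.1.act f x • Y.2 x + f x • (bracket X Y).2 x

/-- A global smooth trivialization `F ≅ M × W'` of the vector bundle `F`: a diffeomorphism over
the identity of `M` which is a linear isomorphism on each fibre. -/
structure SmoothTrivialization [∀ x, AddCommGroup (F x)] [∀ x, Module ℝ (F x)]
    (W' : Type*) [NormedAddCommGroup W'] [NormedSpace ℝ W'] where
  toDiffeomorph : Bundle.TotalSpace W F ≃ₘ⟮𝓘(ℝ, E).prod 𝓘(ℝ, W), 𝓘(ℝ, E).prod 𝓘(ℝ, W')⟯ (M × W')
  fiberEquiv : ∀ x, F x ≃ₗ[ℝ] W'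
  toDiffeomorph_apply : ∀ (x : M) (v : F x), toDiffeomorph ⟨x, v⟩ = (x, fiberEquiv x v)

variable {E M W F}

/-- The `W'`-valued function on `M` that corresponds to a section of `F` in a trivialization. -/
noncomputable def SmoothTrivialization.toFunction [∀ x, AddCommGroup (F x)] [∀ x, Module ℝ (F x)]
    {W' : Type*} [NormedAddCommGroup W'] [NormedSpace ℝ W']
    (φ : SmoothTrivialization E M W F W') (α : OddField E M W F) (x : M) : W' :=
  φ.fiberEquiv x (α x)

end SuperTangent

/-! The bracket of an even with an odd field is a flat connection on `F`. By the Leibniz rule, `∇_U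
s = [U, s]` is a derivation in `s`. It is linear over functions in `U`: skew-symmetry turns `[fU,
s]` into `-[s, fU]`, and the odd field `s` kills `f`. The Jacobi identity for two even fields and
one odd field says that the curvature vanishes. What remains is the classical fact that a flat
bundle over a simply connected base has a global parallel frame.

Locally, `∇ = d + A` in a chart and a trivialization, and flatness is the structure equation of the
matrix-valued form `A`. If `P` is invertible with `dP = P A`, then `d(P s) = P (ds + A s)`, so `P`
turns the trivialization into a parallel frame. Such a `P` is found by solving the equation along
rays from the centre; flatness forces the radial solution to solve it in every direction
(`hasFDerivAt_radial_of_flat`, `exists_gauge_of_flat`).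

Globally, two parallel frames differ by a locally constant automorphism of `W`. These transitions
form a cocycle with values in a discrete group, hence define a covering of `M`. Simple connectedness
gives it a section, which exhibits the cocycle as a coboundary
(`exists_coboundary_of_locallyConstant_cocycle`) and corrects the local frames so that they agree
(`exists_parallelFrame_univ`). -/

/-! ### Flat connection forms on a vector space and their local gauges. -/

section FlatConnectionForm

open Set Metric Topology

variable {R : Type*} [NormedRing R] [NormedAlgebra ℝ R]

/-- The linear equation `h' = h a` with `h 0 = 1` and `‖a‖ ≤ 1/2` is solvable on `[0, 1]`. -/
theorem exists_hasDerivWithinAt_mul_of_norm_le_half [CompleteSpace R] (a : ℝ → R)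
    (ha : ContinuousOn a (Icc 0 1)) (hb : ∀ t ∈ Icc (0 : ℝ) 1, ‖a t‖ ≤ 1 / 2) :
    ∃ h : ℝ → R, h 0 = 1 ∧
      ∀ t ∈ Icc (0 : ℝ) 1, HasDerivWithinAt h (h t * a t) (Icc 0 1) t := by
  -- On the ball of radius `‖1‖` about `1` one has `‖x‖ ≤ 2‖1‖`, so the speed is at most `‖1‖`:
  -- solutions stay in the ball for exactly unit time. This is where the bound `1 / 2` comes from.
  have key : IsPicardLindelof (fun t h => h * a t) (tmin := 0) (tmax := 1)
      ⟨0, by simp⟩ (1 : R) ‖(1 : R)‖₊ 0 ‖(1 : R)‖₊ (1 / 2) := by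
    refine ⟨fun t ht => ?_, fun x _ => continuousOn_const.mul ha, fun t ht x hx => ?_, by simp⟩
    · refine LipschitzOnWith.of_dist_le_mul fun x _ y _ => ?_
      rw [dist_eq_norm, dist_eq_norm, ← sub_mul]
      refine (norm_mul_le _ _).trans ?_
      rw [mul_comm]
      have := hb t ht
      push_cast
      gcongr
    · rw [mem_closedBall, dist_eq_norm] at hx
      have h1 : ‖x‖ ≤ ‖(1 : R)‖ + ‖(1 : R)‖ := by
        calc ‖x‖ = ‖(x - 1) + 1‖ := by simp
          _ ≤ _ := (norm_add_le _ _).trans (by gcongr; exact hx)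
      refine (norm_mul_le _ _).trans ?_
      have := hb t ht
      calc ‖x‖ * ‖a t‖ ≤ (‖(1 : R)‖ + ‖(1 : R)‖) * (1 / 2) := by gcongr
        _ = _ := by rw [coe_nnnorm]; ring
  obtain ⟨h, h0, h1⟩ := key.exists_eq_forall_mem_Icc_hasDerivWithinAt₀
  exact ⟨h, h0, h1⟩

variable {E : Type*} [NormedAddCommGroup E] [NormedSpace ℝ E]

/-- The derivative of a `C²` function is locally Lipschitz, so the Taylor remainder is quadratic,
uniformly in the base point. This is all the regularity of `A` that the Grönwall argument uses. -/
theorem exists_ball_norm_image_sub_sub_le {G : Type*} [NormedAddCommGroup G] [NormedSpace ℝ G]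
    {f : E → G} {c : E} (hf : ContDiffAt ℝ 2 f c) :
    ∃ r > 0, ∃ M ≥ (0 : ℝ), ∀ x ∈ ball c r, DifferentiableAt ℝ f x ∧ ‖f x‖ ≤ M ∧ ‖fderiv ℝ f x‖ ≤ M ∧
      ∀ y ∈ ball c r, ‖f y - f x - fderiv ℝ f x (y - x)‖ ≤ M * ‖y - x‖ ^ 2 := by
  have h1 : ContDiffAt ℝ 1 (fderiv ℝ f) c := hf.fderiv_right (by norm_num)
  obtain ⟨K, t, ht, hK⟩ := h1.exists_lipschitzOnWith
  have hd : ∀ᶠ x in 𝓝 c, DifferentiableAt ℝ f x :=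
    (hf.eventually (by simp)).mono fun x hx => hx.differentiableAt (by simp)
  have hn1 : ∀ᶠ x in 𝓝 c, ‖f x‖ < ‖f c‖ + 1 :=
    hf.continuousAt.norm.eventually_lt continuousAt_const (by simp)
  have hn2 : ∀ᶠ x in 𝓝 c, ‖fderiv ℝ f x‖ < ‖fderiv ℝ f c‖ + 1 :=
    h1.continuousAt.norm.eventually_lt continuousAt_const (by simp)
  obtain ⟨r, hr, hball⟩ := Metric.mem_nhds_iff.1
    (Filter.inter_mem ht (hd.and (hn1.and hn2)))
  refine ⟨r, hr, max K (max (‖f c‖ + 1) (‖fderiv ℝ f c‖ + 1)), by positivity, fun x hx => ?_⟩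
  obtain ⟨hxt, hxd, hx1, hx2⟩ := hball hx
  refine ⟨hxd, hx1.le.trans (by simp), hx2.le.trans (by simp), fun y hy => ?_⟩
  -- On this convex set the derivative differs from `fderiv ℝ f x` by at most `K * ‖y - x‖`, so the
  -- mean value inequality gives the quadratic bound.
  have hconv : Convex ℝ (ball c r ∩ closedBall x ‖y - x‖) :=
    (convex_ball _ _).inter (convex_closedBall _ _)
  have := hconv.norm_image_sub_le_of_norm_hasFDerivWithin_le' (𝕜 := ℝ) (f := f) (f' := fderiv ℝ f)
    (φ := fderiv ℝ f x) (C := K * ‖y - x‖) (x := x) (y := y)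
    (fun z hz => (hball hz.1).2.1.hasFDerivAt.hasFDerivWithinAt) (fun z hz => ?_)
    ⟨hx, by simp⟩ ⟨hy, by simp [dist_eq_norm]⟩
  · refine this.trans ?_
    rw [mul_assoc, ← sq]
    gcongr
    exact le_max_left _ _
  · have h2 := hK.dist_le_mul z (hball hz.1).1 x hxt
    rw [dist_eq_norm] at h2
    refine h2.trans ?_
    gcongr
    simpa using hz.2

/-- The radial solution of `dP = P A`, for a flat connection form `A`, solves the equation in every
direction. -/
theorem hasFDerivAt_radial_of_flat {A : E → E →L[ℝ] R} {c : E} {r M : ℝ} (hM : 0 ≤ M)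
    (hMr : M * r ≤ 1 / 2)
    (hA : ∀ x ∈ ball c r, DifferentiableAt ℝ A x ∧ ‖A x‖ ≤ M ∧ ‖fderiv ℝ A x‖ ≤ M ∧
      ∀ y ∈ ball c r, ‖A y - A x - fderiv ℝ A x (y - x)‖ ≤ M * ‖y - x‖ ^ 2)
    (hflat : ∀ x ∈ ball c r, ∀ v w, fderiv ℝ A x v w + A x v * A x w =
      fderiv ℝ A x w v + A x w * A x v)
    {h : E → ℝ → R} (h0 : ∀ x ∈ ball c r, h x 0 = 1)
    (hh : ∀ x ∈ ball c r, ∀ t ∈ Icc (0 : ℝ) 1,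
      HasDerivWithinAt (h x) (h x t * A (c + t • (x - c)) (x - c)) (Icc 0 1) t)
    {x : E} (hx : x ∈ ball c r) :
    HasFDerivAt (fun y => h y 1) ((ContinuousLinearMap.mul ℝ R (h x 1)).comp (A x)) x := by
  have hmem : ∀ y ∈ ball c r, ∀ t ∈ Icc (0 : ℝ) 1, c + t • (y - c) ∈ ball c r := by
    intro y hy t ht
    rw [mem_ball, dist_eq_norm] at hy ⊢
    rw [add_sub_cancel_left, norm_smul, Real.norm_of_nonneg ht.1]
    calc t * ‖y - c‖ ≤ 1 * ‖y - c‖ := by gcongr; exact ht.2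
      _ < r := by simpa using hy
  have hr : 0 < r := dist_nonneg.trans_lt hx
  have hcont : ContinuousOn (h x) (Icc 0 1) := fun t ht => (hh x hx t ht).continuousWithinAt
  obtain ⟨H, hH⟩ := isCompact_Icc.exists_bound_of_continuousOn hcont
  have hH0 : 0 ≤ H := (norm_nonneg _).trans (hH 0 (by simp))
  set B : ℝ := H * (M + M * r + M * (M + (M + M * r) * r + M * r)) with hB
  have main : ∀ y ∈ ball c r, ‖y - x‖ ≤ r →
      ‖h y 1 - h x 1 - h x 1 * A x (y - x)‖ ≤
        B * (2 * (Real.exp (1 / 2) - 1)) * ‖y - x‖ ^ 2 := by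
    intro y hy hyx
    set v := y - x with hv
    set ξ := x - c with hξ
    have hη : y - c = ξ + v := by rw [hv, hξ]; abel
    have hηr : ‖ξ + v‖ ≤ r := by rw [← hη, ← dist_eq_norm]; exact (mem_ball.1 hy).le
    -- At time `t` the rays to `x` and `y` are `t • v` apart, so `t • (h x t * A v)` is the expected
    -- first variation; `d` is its error, to be shown quadratic in `v`.
    set d : ℝ → R := fun t => h y t - h x t - t • (h x t * A (c + t • ξ) v) with hd
    set d' : ℝ → R := fun t => h y t * A (c + t • (ξ + v)) (ξ + v) - h x t * A (c + t • ξ) ξ -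
      (t • (h x t * A (c + t • ξ) ξ * A (c + t • ξ) v + h x t * fderiv ℝ A (c + t • ξ) ξ v)
        + (1 : ℝ) • (h x t * A (c + t • ξ) v)) with hd'
    have hder : ∀ t ∈ Icc (0 : ℝ) 1, HasDerivWithinAt d (d' t) (Icc 0 1) t := by
      intro t ht
      have e1 := hh y hy t ht
      rw [hη] at e1
      have e2 := hh x hx t ht
      have e3 : HasDerivWithinAt (fun t : ℝ => c + t • ξ) ((1 : ℝ) • ξ) (Icc 0 1) t :=
        ((hasDerivWithinAt_id t _).smul_const ξ).const_add c
      have e4 := (hA _ (hmem x hx t ht)).1.hasFDerivAt.comp_hasDerivWithinAt t e3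
      have e5 := e4.clm_apply (hasDerivWithinAt_const t _ v)
      rw [one_smul] at e5
      have e6 := (hasDerivWithinAt_id t (Icc 0 1)).smul (e2.mul e5)
      refine ((e1.sub e2).sub e6).congr_deriv ?_
      simp [hd', hξ]
    have hbound : ∀ t ∈ Ico (0 : ℝ) 1, ‖d' t‖ ≤ 1 / 2 * ‖d t‖ + B * ‖v‖ ^ 2 := by
      intro t ht
      have ht' := Ico_subset_Icc_self ht
      set p := c + t • ξ with hp
      set q := c + t • (ξ + v) with hq
      have hpm : p ∈ ball c r := hmem x hx t ht'
      have hqm : q ∈ ball c r := by rw [hq, ← hη]; exact hmem y hy t ht'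
      obtain ⟨-, hA1, hA2, hA3⟩ := hA p hpm
      have hAq := (hA q hqm).2.1
      have hqp : q - p = t • v := by rw [hp, hq]; simp
      set ρ := A q - A p - fderiv ℝ A p (q - p) with hρ
      have hρn : ‖ρ‖ ≤ M * ‖v‖ ^ 2 := by
        refine (hA3 q hqm).trans ?_
        rw [hqp, norm_smul, Real.norm_of_nonneg ht.1]
        have : t * ‖v‖ ≤ ‖v‖ := mul_le_of_le_one_left (norm_nonneg _) ht.2.le
        have : 0 ≤ t * ‖v‖ := mul_nonneg ht.1 (norm_nonneg _)
        gcongr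
      have hAqe : A q = A p + t • fderiv ℝ A p v + ρ := by
        rw [hρ, hqp, map_smul]; abel
      have hfl := hflat p hpm ξ v
      -- Flatness trades the derivative of `A` along `ξ` for the one along `v` plus a commutator.
      -- All terms of first order in `v` then cancel, apart from those carried by the factor `d t`.
      have hdecomp : d' t = d t * A q (ξ + v) + h x t * (t • fderiv ℝ A p v v + ρ (ξ + v)
          + t • (A p v * (A p v + (t • fderiv ℝ A p v (ξ + v) + ρ (ξ + v))))) := by
        have hfl' : fderiv ℝ A p ξ v = fderiv ℝ A p v ξ + A p v * A p ξ - A p ξ * A p v := by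
          rw [← hfl]; abel
        simp only [hd', hd]
        rw [hfl', hAqe]
        simp only [_root_.add_apply, _root_.smul_apply, map_add,
          mul_add, sub_mul, mul_sub, smul_add, smul_sub, one_smul, mul_smul_comm,
          smul_mul_assoc, mul_assoc]
        abel
      rw [hdecomp]
      have hv0 := norm_nonneg v
      have n1 : ‖d t * A q (ξ + v)‖ ≤ 1 / 2 * ‖d t‖ := by
        calc _ ≤ ‖d t‖ * (M * r) := by
              refine (norm_mul_le _ _).trans ?_
              gcongr
              exact (A q).le_of_opNorm_le_of_le hAq hηr
          _ ≤ _ := by rw [mul_comm]; gcongr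
      have n2 : ‖fderiv ℝ A p v‖ ≤ M * ‖v‖ := ContinuousLinearMap.le_of_opNorm_le _ hA2 v
      have n3 : ‖t • fderiv ℝ A p v v‖ ≤ M * ‖v‖ ^ 2 := by
        rw [norm_smul, Real.norm_of_nonneg ht.1]
        calc _ ≤ 1 * (M * ‖v‖ * ‖v‖) := by
              gcongr
              · exact ht.2.le
              · exact ContinuousLinearMap.le_of_opNorm_le _ n2 v
          _ = _ := by ring
      have n4 : ‖ρ (ξ + v)‖ ≤ M * ‖v‖ ^ 2 * r := ρ.le_of_opNorm_le_of_le hρn hηr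
      have n5 : ‖A p v‖ ≤ M * ‖v‖ := ContinuousLinearMap.le_of_opNorm_le _ hA1 v
      have n6 : ‖t • fderiv ℝ A p v (ξ + v)‖ ≤ M * ‖v‖ * r := by
        rw [norm_smul, Real.norm_of_nonneg ht.1]
        calc _ ≤ 1 * (M * ‖v‖ * r) := by
              gcongr
              · exact ht.2.le
              · exact ContinuousLinearMap.le_of_opNorm_le_of_le _ n2 hηr
          _ = _ := by ring
      have n7 : ‖A p v + (t • fderiv ℝ A p v (ξ + v) + ρ (ξ + v))‖ ≤
          M * ‖v‖ + (M * ‖v‖ * r + M * ‖v‖ ^ 2 * r) :=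
        (norm_add_le _ _).trans (add_le_add n5 ((norm_add_le _ _).trans (add_le_add n6 n4)))
      have n8 : ‖t • (A p v * (A p v + (t • fderiv ℝ A p v (ξ + v) + ρ (ξ + v))))‖ ≤
          M * ‖v‖ * (M * ‖v‖ + (M * ‖v‖ * r + M * ‖v‖ ^ 2 * r)) := by
        rw [norm_smul, Real.norm_of_nonneg ht.1]
        calc _ ≤ 1 * (M * ‖v‖ * (M * ‖v‖ + (M * ‖v‖ * r + M * ‖v‖ ^ 2 * r))) := by
              gcongr
              · exact ht.2.le
              · exact (norm_mul_le _ _).trans (by gcongr)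
          _ = _ := by ring
      have n9 : M * ‖v‖ * (M * ‖v‖ + (M * ‖v‖ * r + M * ‖v‖ ^ 2 * r)) ≤
          M * (M + (M + M * r) * r + M * r) * ‖v‖ ^ 2 := by
        have : M * ‖v‖ ^ 2 * r ≤ M * ‖v‖ * r * r := by
          calc M * ‖v‖ ^ 2 * r = M * ‖v‖ * r * ‖v‖ := by ring
            _ ≤ _ := by gcongr
        calc _ ≤ M * ‖v‖ * (M * ‖v‖ + (M * ‖v‖ * r + M * ‖v‖ * r * r)) := by gcongr
          _ = M * (M + (M + M * r) * r) * ‖v‖ ^ 2 := by ring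
          _ ≤ _ := by
            have : 0 ≤ M * r := by positivity
            refine mul_le_mul_of_nonneg_right (mul_le_mul_of_nonneg_left ?_ hM) (by positivity)
            linarith
      refine (norm_add_le _ _).trans (add_le_add n1 ?_)
      calc _ ≤ H * (M * ‖v‖ ^ 2 + M * ‖v‖ ^ 2 * r +
            M * (M + (M + M * r) * r + M * r) * ‖v‖ ^ 2) := by
            refine (norm_mul_le _ _).trans ?_
            gcongr
            · exact hH t ht'
            · exact (norm_add_le _ _).trans (add_le_add ((norm_add_le _ _).trans
                (add_le_add n3 n4)) (n8.trans n9))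
        _ = B * ‖v‖ ^ 2 := by rw [hB]; ring
    -- Both solutions start at `1`, so `d 0 = 0` and Grönwall's inequality leaves only the quadratic
    -- forcing term.
    have gr := norm_le_gronwallBound_of_norm_deriv_right_le (f := d) (f' := d') (δ := 0)
      (K := 1 / 2) (ε := B * ‖v‖ ^ 2) (a := 0) (b := 1)
      (fun t ht => (hder t ht).continuousWithinAt)
      (fun t ht => (hder t (Ico_subset_Icc_self ht)).mono_of_mem_nhdsWithin
        (Icc_mem_nhdsGE_of_mem ht)) (by simp [hd, h0 x hx, h0 y hy]) hbound 1 (by simp)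
    rw [gronwallBound_of_K_ne_0 (by norm_num)] at gr
    simp only [hd, hξ, one_smul, add_sub_cancel] at gr
    refine gr.trans (le_of_eq ?_)
    norm_num
    ring
  refine HasFDerivAt.of_isLittleO ?_
  refine Asymptotics.IsBigO.trans_isLittleO (g := fun y => ‖y - x‖ ^ 2) ?_ ?_
  · refine Asymptotics.IsBigO.of_bound (B * (2 * (Real.exp (1 / 2) - 1))) ?_
    filter_upwards [isOpen_ball.mem_nhds hx, closedBall_mem_nhds x hr] with y hy hy'
    simpa [dist_eq_norm] using main y hy (by simpa [dist_eq_norm] using hy')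
  · exact Asymptotics.isLittleO_pow_sub_sub x (by norm_num)

/-- A flat connection form is locally a pure gauge: `dP = P A` has invertible local solutions. -/
theorem exists_gauge_of_flat [CompleteSpace R] {A : E → E →L[ℝ] R} {c : E} {Ω : Set E} (hΩ : Ω ∈ 𝓝 c)
    (hA : ContDiffOn ℝ ∞ A Ω)
    (hflat : ∀ x ∈ Ω, ∀ v w, fderiv ℝ A x v w + A x v * A x w =
      fderiv ℝ A x w v + A x w * A x v) :
    ∃ r > 0, ball c r ⊆ Ω ∧ ∃ P : E → R, ContDiffOn ℝ ∞ P (ball c r) ∧ ∀ x ∈ ball c r,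
      IsUnit (P x) ∧ HasFDerivAt P ((ContinuousLinearMap.mul ℝ R (P x)).comp (A x)) x := by
  obtain ⟨r₁, hr₁, M, hM, h1⟩ := exists_ball_norm_image_sub_sub_le
    ((hA.contDiffAt hΩ).of_le (by exact WithTop.coe_le_coe.2 le_top) : ContDiffAt ℝ 2 A c)
  obtain ⟨r₂, hr₂, h2⟩ := Metric.mem_nhds_iff.1 hΩ
  -- The last bound gives `M * r ≤ 1 / 2`, which makes the radial equation solvable up to time `1`.
  set r := min (min r₁ r₂) (1 / (2 * (M + 1))) with hr
  have hr0 : 0 < r := by positivity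
  have hrr₁ : ball c r ⊆ ball c r₁ := ball_subset_ball ((min_le_left _ _).trans (min_le_left _ _))
  have hrr₂ : ball c r ⊆ Ω :=
    (ball_subset_ball ((min_le_left _ _).trans (min_le_right _ _))).trans h2
  have hMr : M * r ≤ 1 / 2 := by
    calc M * r ≤ (M + 1) * (1 / (2 * (M + 1))) := by
          gcongr
          · linarith
          · exact min_le_right _ _
      _ = 1 / 2 := by field_simp
  have hmem : ∀ y ∈ ball c r, ∀ t ∈ Icc (0 : ℝ) 1, c + t • (y - c) ∈ ball c r := by
    intro y hy t ht
    rw [mem_ball, dist_eq_norm] at hy ⊢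
    rw [add_sub_cancel_left, norm_smul, Real.norm_of_nonneg ht.1]
    calc t * ‖y - c‖ ≤ 1 * ‖y - c‖ := by gcongr; exact ht.2
      _ < r := by simpa using hy
  have hex : ∀ x ∈ ball c r, ∃ h : ℝ → R, h 0 = 1 ∧ ∀ t ∈ Icc (0 : ℝ) 1,
      HasDerivWithinAt h (h t * A (c + t • (x - c)) (x - c)) (Icc 0 1) t := by
    intro x hx
    refine exists_hasDerivWithinAt_mul_of_norm_le_half _ ?_ fun t ht => ?_
    · refine ContinuousOn.clm_apply ?_ continuousOn_const
      exact hA.continuousOn.comp (by fun_prop) fun t ht => hrr₂ (hmem x hx t ht)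
    · refine ((A _).le_of_opNorm_le_of_le (h1 _ (hrr₁ (hmem x hx t ht))).2.1 ?_).trans hMr
      rw [← dist_eq_norm]
      exact (mem_ball.1 hx).le
  choose! h h0 hh using hex
  have hP : ∀ x ∈ ball c r, HasFDerivAt (fun y => h y 1)
      ((ContinuousLinearMap.mul ℝ R (h x 1)).comp (A x)) x := fun x hx =>
    hasFDerivAt_radial_of_flat hM hMr
      (fun x hx => ⟨(h1 x (hrr₁ hx)).1, (h1 x (hrr₁ hx)).2.1, (h1 x (hrr₁ hx)).2.2.1,
        fun y hy => (h1 x (hrr₁ hx)).2.2.2 y (hrr₁ hy)⟩)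
      (fun x hx => hflat x (hrr₂ hx)) h0 hh hx
  -- Bootstrap from `dP = P A`: if `P` is `C^n`, so is its derivative, hence `P` is `C^(n+1)`.
  -- Smooth dependence of ODE solutions on parameters is not needed.
  have hsm : ∀ n : ℕ, ContDiffOn ℝ n (fun y => h y 1) (ball c r) := by
    intro n
    induction n with
    | zero => exact contDiffOn_zero.2 fun x hx => (hP x hx).continuousAt.continuousWithinAt
    | succ n ih =>
      push_cast
      rw [contDiffOn_succ_iff_fderiv_of_isOpen isOpen_ball]
      refine ⟨fun x hx => (hP x hx).differentiableAt.differentiableWithinAt, by simp, ?_⟩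
      refine ContDiffOn.congr (f := fun x => (ContinuousLinearMap.mul ℝ R (h x 1)).comp (A x)) ?_
        fun x hx => (hP x hx).fderiv
      exact ((ContinuousLinearMap.mul ℝ R).contDiff.comp_contDiffOn ih).clm_comp
        ((hA.mono hrr₂).of_le (by exact_mod_cast le_top))
  -- The ray from `c` to itself is constant, so the equation there is `h' = 0`. Invertibility near
  -- `c` follows because units are open.
  have hc : h c 1 = 1 := by
    have hcb : c ∈ ball c r := mem_ball_self hr0
    have := constant_of_has_deriv_right_zero (f := h c) (a := 0) (b := 1)
      (fun t ht => (hh c hcb t ht).continuousWithinAt)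
      (fun t ht => by
        simpa using (hh c hcb t (Ico_subset_Icc_self ht)).mono_of_mem_nhdsWithin
          (Icc_mem_nhdsGE_of_mem ht)) 1 (by simp)
    rw [this, h0 c hcb]
  have hunit : ∀ᶠ x in 𝓝 c, IsUnit (h x 1) := by
    refine (hP c (mem_ball_self hr0)).continuousAt.eventually_mem (s := {x | IsUnit x}) ?_
    exact Units.isOpen.mem_nhds (by simp [hc])
  obtain ⟨r₃, hr₃, h3⟩ := Metric.mem_nhds_iff.1 hunit
  have hs : ball c (min r r₃) ⊆ ball c r := ball_subset_ball (min_le_left _ _)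
  exact ⟨min r r₃, lt_min hr0 hr₃, hs.trans hrr₂, fun y => h y 1,
    (contDiffOn_infty.2 hsm).mono hs,
    fun x hx => ⟨h3 (ball_subset_ball (min_le_right _ _) hx), hP x (hs hx)⟩⟩

theorem hasFDerivAt_clm_apply_const {V G : Type*} [NormedAddCommGroup V] [NormedSpace ℝ V]
    [NormedAddCommGroup G] [NormedSpace ℝ G] {A : E → V →L[ℝ] G} {A' : E →L[ℝ] V →L[ℝ] G} {x : E}
    (hA : HasFDerivAt A A' x) (v : V) : HasFDerivAt (fun y => A y v) (A'.flip v) x := by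
  simpa using hA.clm_apply (hasFDerivAt_const v x)

end FlatConnectionForm

/-! ### Locally constant cocycles on simply connected spaces. -/

section LocallyConstantCocycle

open Topology Set

/-- On a simply connected space every locally constant cocycle is a coboundary. -/
theorem exists_coboundary_of_locallyConstant_cocycle {B ι G : Type*} [TopologicalSpace B]
    [SimplyConnectedSpace B] [LocallyPathConnectedSpace B] [Group G] (U : ι → Set B)
    (hU : ∀ i, IsOpen (U i)) (idx : B → ι) (hidx : ∀ x, x ∈ U (idx x)) (T : ι → ι → B → G)
    (hT : ∀ i j, ∀ x ∈ U i ∩ U j, ∀ᶠ y in 𝓝 x, T i j y = T i j x)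
    (hself : ∀ i, ∀ x ∈ U i, T i i x = 1)
    (hcomp : ∀ i j k, ∀ x ∈ U i ∩ U j ∩ U k, T j k x * T i j x = T i k x) :
    ∃ s : ι → B → G, (∀ i, ∀ x ∈ U i, ∀ᶠ y in 𝓝 x, s i y = s i x) ∧
      ∀ i j, ∀ x ∈ U i ∩ U j, s j x = T i j x * s i x := by
  -- With the discrete topology on `G`, local constancy is continuity of the transition maps, and
  -- the bundle glued by left multiplication is a covering. Lifting the identity of `B` gives a
  -- global section `σ`.
  let _ : TopologicalSpace G := ⊥
  have _ : DiscreteTopology G := ⟨rfl⟩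
  let Z : FiberBundleCore ι B G :=
    { baseSet := U
      isOpen_baseSet := hU
      indexAt := idx
      mem_baseSet_at := hidx
      coordChange := fun i j x g => T i j x * g
      coordChange_self := fun i x hx v => by rw [hself i x hx, one_mul]
      continuousOn_coordChange := fun i j => by
        rintro ⟨x, g⟩ ⟨hx, -⟩
        refine ContinuousAt.continuousWithinAt ?_
        refine ContinuousAt.mul (f := fun p : B × G => T i j p.1) ?_ continuousAt_snd
        refine ContinuousAt.comp (f := Prod.fst) (g := T i j) ?_ continuousAt_fst
        exact continuousAt_const.congr ((hT i j x hx).mono fun y hy => hy.symm)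
      coordChange_comp := fun i j k x hx v => by rw [← mul_assoc, hcomp i j k x hx] }
  have hcov : IsCoveringMap (Bundle.TotalSpace.proj : Z.TotalSpace → B) :=
    FiberBundle.isCoveringMap (F := G) (E := Z.Fiber)
  obtain ⟨b⟩ : Nonempty B := inferInstance
  obtain ⟨σ, ⟨-, hσ⟩, -⟩ := hcov.existsUnique_continuousMap_lifts (ContinuousMap.id B) b
    (⟨b, (1 : G)⟩ : Z.TotalSpace) rfl
  have hσ' : ∀ x, (σ x).proj = x := fun x => congrFun hσ x
  -- The coboundary is `σ` read in the local trivializations: continuous into a discrete space,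
  -- hence locally constant.
  refine ⟨fun i x => (Z.localTriv i (σ x)).2, fun i x hx => ?_, fun i j x hx => ?_⟩
  · have h1 : ContinuousAt (Z.localTriv i) (σ x) := by
      refine (Z.localTriv i).continuousOn.continuousAt ((Z.localTriv i).open_source.mem_nhds ?_)
      rw [Z.mem_localTriv_source, ← Z.baseSet_at, hσ' x]
      exact hx
    have h2 : ContinuousAt (fun y => (Z.localTriv i (σ y)).2) x :=
      continuousAt_snd.comp (h1.comp σ.continuous.continuousAt)
    exact h2.eventually_mem (s := {(Z.localTriv i (σ x)).2}) ((isOpen_discrete _).mem_nhds rfl)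
  · simp only [Z.localTriv_apply, hσ' x]
    exact (Z.coordChange_comp _ _ _ x ⟨⟨hidx x, hx.1⟩, hx.2⟩ _).symm

end LocallyConstantCocycle

/-! ### Cutoffs, and first order operators on global sections. -/

section Sections

open Topology Set Bundle

variable {E : Type*} [NormedAddCommGroup E] [NormedSpace ℝ E]
  {M : Type*} [TopologicalSpace M] [ChartedSpace E M]

theorem exists_contMDiffMap_eventuallyEq_one [FiniteDimensional ℝ E] [T2Space M]
    [IsManifold 𝓘(ℝ, E) ∞ M] {x : M} {O : Set M} (hO : O ∈ 𝓝 x) :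
    ∃ ρ : C^∞⟮𝓘(ℝ, E), M; ℝ⟯, (∀ᶠ y in 𝓝 x, ρ y = 1) ∧ tsupport ρ ⊆ O := by
  obtain ⟨f, -, hf⟩ := (SmoothBumpFunction.nhds_basis_tsupport (I := 𝓘(ℝ, E)) x).mem_iff.1 hO
  exact ⟨⟨f, f.contMDiff⟩, f.eventuallyEq_one, hf⟩

variable {W : Type*} [NormedAddCommGroup W] [NormedSpace ℝ W]

theorem mvfderiv_congr_of_eventuallyEq {g h : M → W} {x : M} (H : g =ᶠ[𝓝 x] h) :
    mvfderiv 𝓘(ℝ, E) g x = mvfderiv 𝓘(ℝ, E) h x :=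
  H.mfderiv_eq

theorem mvfderiv_clm_comp {W' : Type*} [NormedAddCommGroup W'] [NormedSpace ℝ W'] (l : W →L[ℝ] W')
    {g : M → W} {x : M} (hg : MDifferentiableAt 𝓘(ℝ, E) 𝓘(ℝ, W) g x)
    (u : TangentSpace 𝓘(ℝ, E) x) :
    mvfderiv 𝓘(ℝ, E) (fun y => l (g y)) x u = l (mvfderiv 𝓘(ℝ, E) g x u) := by
  have h := mfderiv_comp_apply x (l.differentiableAt (x := g x)).mdifferentiableAt hg u
  rw [mfderiv_eq_fderiv, l.fderiv] at h
  exact h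

theorem mdifferentiableAt_extChartAt_symm_of_mem [IsManifold 𝓘(ℝ, E) ∞ M] {c x : M}
    (hx : x ∈ (chartAt E c).source) :
    MDifferentiableAt 𝓘(ℝ, E) 𝓘(ℝ, E) (extChartAt 𝓘(ℝ, E) c).symm (extChartAt 𝓘(ℝ, E) c x) := by
  have hx' : x ∈ (extChartAt 𝓘(ℝ, E) c).source := by rwa [extChartAt_source]
  exact ((contMDiffOn_extChartAt_symm (n := ∞) c).contMDiffAt
    ((isOpen_extChartAt_target c).mem_nhds ((extChartAt 𝓘(ℝ, E) c).map_source hx'))).mdifferentiableAt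
      (by simp)

theorem differentiableAt_comp_extChartAt_symm [IsManifold 𝓘(ℝ, E) ∞ M] {g : M → W} {c x : M}
    (hx : x ∈ (chartAt E c).source) (hg : MDifferentiableAt 𝓘(ℝ, E) 𝓘(ℝ, W) g x) :
    DifferentiableAt ℝ (g ∘ (extChartAt 𝓘(ℝ, E) c).symm) (extChartAt 𝓘(ℝ, E) c x) := by
  have hx' : x ∈ (extChartAt 𝓘(ℝ, E) c).source := by rwa [extChartAt_source]
  refine mdifferentiableAt_iff_differentiableAt.1 ?_
  refine MDifferentiableAt.comp (I' := 𝓘(ℝ, E)) _ ?_ (mdifferentiableAt_extChartAt_symm_of_mem hx)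
  rwa [(extChartAt 𝓘(ℝ, E) c).left_inv hx']

/-- The derivative of a function, computed in the preferred chart at `c`. -/
theorem mvfderiv_eq_fderiv_comp_symm [IsManifold 𝓘(ℝ, E) ∞ M] {g : M → W} {c x : M}
    (hx : x ∈ (chartAt E c).source) (hg : MDifferentiableAt 𝓘(ℝ, E) 𝓘(ℝ, W) g x)
    (u : TangentSpace 𝓘(ℝ, E) x) :
    mvfderiv 𝓘(ℝ, E) g x u = fderiv ℝ (g ∘ (extChartAt 𝓘(ℝ, E) c).symm) (extChartAt 𝓘(ℝ, E) c x)
      ((trivializationAt E (TangentSpace 𝓘(ℝ, E)) c).continuousLinearMapAt ℝ x u) := by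
  have : IsManifold 𝓘(ℝ, E) 1 M := .of_le (n := ∞) (by simp)
  have h := mfderiv_comp_apply x
    (differentiableAt_comp_extChartAt_symm hx hg).mdifferentiableAt
    (mdifferentiableAt_extChartAt hx) u
  rw [mfderiv_eq_fderiv] at h
  rw [TangentBundle.continuousLinearMapAt_trivializationAt hx]
  refine Eq.trans ?_ h
  refine DFunLike.congr_fun (mvfderiv_congr_of_eventuallyEq ?_) u
  filter_upwards [(chartAt E c).open_source.mem_nhds hx] with y hy
  have hy' : y ∈ (extChartAt 𝓘(ℝ, E) c).source := by rwa [extChartAt_source]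
  simp only [Function.comp_apply]
  rw [(extChartAt 𝓘(ℝ, E) c).left_inv hy']

variable {F : M → Type*} [TopologicalSpace (TotalSpace W F)]
  [∀ x, TopologicalSpace (F x)] [FiberBundle W F]
  [∀ x, AddCommGroup (F x)] [∀ x, Module ℝ (F x)] [VectorBundle ℝ W F]

@[simp]
theorem funSMul_apply (f : C^∞⟮𝓘(ℝ, E), M; ℝ⟯) (s : Cₛ^∞⟮𝓘(ℝ, E); W, F⟯) (x : M) :
    funSMul f s x = f x • s x := rfl

theorem funSMul_zero (f : C^∞⟮𝓘(ℝ, E), M; ℝ⟯) :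
    funSMul f (0 : Cₛ^∞⟮𝓘(ℝ, E); W, F⟯) = 0 := by
  ext x
  exact smul_zero (f x)

variable [ContMDiffVectorBundle ∞ W F 𝓘(ℝ, E)]
  (e : Trivialization W (TotalSpace.proj : TotalSpace W F → M)) [MemTrivializationAtlas e]

theorem contMDiffOn_continuousLinearMapAt_section {s : ∀ x, F x} {a : Set M}
    (ha : IsOpen a) (ha' : a ⊆ e.baseSet) :
    ContMDiffOn 𝓘(ℝ, E) (𝓘(ℝ, E).prod 𝓘(ℝ, W)) ∞ (fun x => TotalSpace.mk' W x (s x)) a ↔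
      ContMDiffOn 𝓘(ℝ, E) 𝓘(ℝ, W) ∞ (fun x => e.continuousLinearMapAt ℝ x (s x)) a := by
  rw [e.contMDiffOn_section_iff ha ha']
  refine contMDiffOn_congr fun x hx => ?_
  rw [Trivialization.continuousLinearMapAt_apply, Trivialization.coe_linearMapAt_of_mem e (ha' hx)]

theorem contMDiffOn_symmL_section {a : Set M} (ha : IsOpen a) (ha' : a ⊆ e.baseSet) {g : M → W}
    (hg : ContMDiffOn 𝓘(ℝ, E) 𝓘(ℝ, W) ∞ g a) :
    ContMDiffOn 𝓘(ℝ, E) (𝓘(ℝ, E).prod 𝓘(ℝ, W)) ∞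
      (fun x => TotalSpace.mk' W x (e.symmL ℝ x (g x))) a := by
  rw [contMDiffOn_continuousLinearMapAt_section e ha ha']
  exact hg.congr fun x hx => e.continuousLinearMapAt_symmL (ha' hx) _

/-- The product of a function supported in an open set and a section over that open set. -/
noncomputable def cutoffSection (ρ : C^∞⟮𝓘(ℝ, E), M; ℝ⟯) (s : ∀ x, F x) (a : Set M) (ha : IsOpen a)
    (hρ : tsupport ρ ⊆ a)
    (hs : ContMDiffOn 𝓘(ℝ, E) (𝓘(ℝ, E).prod 𝓘(ℝ, W)) ∞ (fun x => TotalSpace.mk' W x (s x)) a) :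
    Cₛ^∞⟮𝓘(ℝ, E); W, F⟯ :=
  ⟨fun x => ρ x • s x, ContMDiffOn.smul_section_of_tsupport ρ.contMDiff.contMDiffOn ha hρ hs⟩

/-- The extension by a cutoff function of the sections that are constant in a trivialization. -/
noncomputable def extendConst (ρ : C^∞⟮𝓘(ℝ, E), M; ℝ⟯) (hρ : tsupport ρ ⊆ e.baseSet) :
    W →ₗ[ℝ] Cₛ^∞⟮𝓘(ℝ, E); W, F⟯ where
  toFun w := cutoffSection ρ (fun x => e.symmL ℝ x w) e.baseSet e.open_baseSet hρ
    (contMDiffOn_symmL_section e e.open_baseSet subset_rfl contMDiffOn_const)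
  map_add' v w := by ext x; exact (congrArg _ (map_add _ _ _)).trans (smul_add _ _ _)
  map_smul' c w := by ext x; exact (congrArg _ (map_smul _ _ _)).trans (smul_comm _ _ _)

theorem extendConst_apply (ρ : C^∞⟮𝓘(ℝ, E), M; ℝ⟯) (hρ : tsupport ρ ⊆ e.baseSet) (w : W) (x : M) :
    extendConst e ρ hρ w x = ρ x • e.symmL ℝ x w := rfl

theorem continuousLinearMapAt_extendConst (ρ : C^∞⟮𝓘(ℝ, E), M; ℝ⟯) (hρ : tsupport ρ ⊆ e.baseSet)
    {p : M} (hp : ρ p = 1) (w : W) :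
    e.continuousLinearMapAt ℝ p (extendConst e ρ hρ w p) = w := by
  have hpe : p ∈ e.baseSet := hρ (subset_tsupport _ (by simp [hp]))
  rw [extendConst_apply, hp, one_smul, e.continuousLinearMapAt_symmL hpe]

variable [FiniteDimensional ℝ W]

/-- The product of a cutoff function and a coordinate of a section in a trivialization. -/
noncomputable def cutoffCoord (ρ : C^∞⟮𝓘(ℝ, E), M; ℝ⟯) (hρ : tsupport ρ ⊆ e.baseSet)
    (s : Cₛ^∞⟮𝓘(ℝ, E); W, F⟯) (l : W →L[ℝ] ℝ) : C^∞⟮𝓘(ℝ, E), M; ℝ⟯ :=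
  ⟨fun x => ρ x • l (e.continuousLinearMapAt ℝ x (s x)), by
    refine contMDiff_of_tsupport fun x hx => ?_
    have hx' : x ∈ e.baseSet := hρ (closure_mono (Function.support_smul_subset_left _ _) hx)
    refine ρ.contMDiff.contMDiffAt.smul (l.contMDiff.contMDiffAt.comp x ?_)
    exact ((contMDiffOn_continuousLinearMapAt_section e e.open_baseSet subset_rfl).1
      s.contMDiff.contMDiffOn).contMDiffAt (e.open_baseSet.mem_nhds hx')⟩

/-- One factor `ρ` makes the coordinates of `s` global functions, the other makes the local frame
global. An operator defined only on global sections can thus be expanded in a local frame. -/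
theorem sq_smul_eq_sum_cutoffCoord_extendConst (ρ : C^∞⟮𝓘(ℝ, E), M; ℝ⟯)
    (hρ : tsupport ρ ⊆ e.baseSet) (s : Cₛ^∞⟮𝓘(ℝ, E); W, F⟯) :
    funSMul (ρ * ρ) s = ∑ i, funSMul (cutoffCoord e ρ hρ s
      (LinearMap.toContinuousLinearMap ((Module.finBasis ℝ W).coord i)))
        (extendConst e ρ hρ (Module.finBasis ℝ W i)) := by
  ext x
  have hsum : ∀ t : Fin (Module.finrank ℝ W) → Cₛ^∞⟮𝓘(ℝ, E); W, F⟯, (∑ i, t i) x = ∑ i, t i x := by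
    intro t
    let ev : Cₛ^∞⟮𝓘(ℝ, E); W, F⟯ →+ F x := ⟨⟨fun s => s x, rfl⟩, fun _ _ => rfl⟩
    exact map_sum ev t _
  rw [hsum]
  simp only [funSMul_apply, extendConst_apply]
  by_cases hx : x ∈ e.baseSet
  · have h1 : s x = e.symmL ℝ x (∑ i, (Module.finBasis ℝ W).repr
        (e.continuousLinearMapAt ℝ x (s x)) i • Module.finBasis ℝ W i) := by
      rw [Module.Basis.sum_repr, e.symmL_continuousLinearMapAt hx]
    conv_lhs => rw [h1]
    rw [map_sum, Finset.smul_sum]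
    refine Finset.sum_congr rfl fun i _ => ?_
    rw [map_smul, smul_smul, smul_smul]
    congr 1
    change ρ x * ρ x * _ = ρ x * (Module.finBasis ℝ W).coord i _ * ρ x
    rw [Module.Basis.coord_apply]
    ring
  · have h0 : ρ x = 0 := image_eq_zero_of_notMem_tsupport fun h => hx (hρ h)
    change (ρ x * ρ x) • _ = _
    simp [h0]

/-- A first order operator on sections is determined at a point by its values on the sections
which are constant in a trivialization. -/
theorem eq_symbol_add_extendConst {V : Type*} [AddCommGroup V] [Module ℝ V] {p : M}
    (ρ : C^∞⟮𝓘(ℝ, E), M; ℝ⟯) (hρ : tsupport ρ ⊆ e.baseSet) (hp : ∀ᶠ y in 𝓝 p, ρ y = 1)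
    (T : Cₛ^∞⟮𝓘(ℝ, E); W, F⟯ →ₗ[ℝ] V) (L : F p →ₗ[ℝ] V) (u : TangentSpace 𝓘(ℝ, E) p)
    (hT : ∀ f s, T (funSMul f s) = mvfderiv 𝓘(ℝ, E) f p u • L (s p) + f p • T s)
    (s : Cₛ^∞⟮𝓘(ℝ, E); W, F⟯) :
    T s = L (e.symmL ℝ p
        (mvfderiv 𝓘(ℝ, E) (fun x => e.continuousLinearMapAt ℝ x (s x)) p u)) +
      T (extendConst e ρ hρ (e.continuousLinearMapAt ℝ p (s p))) := by
  have hp1 : ρ p = 1 := hp.self_of_nhds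
  have hpe : p ∈ e.baseSet := hρ (subset_tsupport _ (by simp [hp1]))
  have hd : MDifferentiableAt 𝓘(ℝ, E) 𝓘(ℝ, W) (fun x => e.continuousLinearMapAt ℝ x (s x)) p :=
    (((contMDiffOn_continuousLinearMapAt_section e e.open_baseSet subset_rfl).1
      s.contMDiff.contMDiffOn).contMDiffAt (e.open_baseSet.mem_nhds hpe)).mdifferentiableAt
        (by simp)
  -- Locality at `p`: `ρ * ρ` is `1` near `p`, so its derivative drops out of the Leibniz rule.
  have h1 : T (funSMul (ρ * ρ) s) = T s := by
    rw [hT]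
    have : mvfderiv 𝓘(ℝ, E) (ρ * ρ : C^∞⟮𝓘(ℝ, E), M; ℝ⟯) p = 0 := by
      have : ((ρ * ρ : C^∞⟮𝓘(ℝ, E), M; ℝ⟯) : M → ℝ) =ᶠ[𝓝 p] fun _ => 1 := by
        filter_upwards [hp] with y hy
        change ρ y * ρ y = 1
        simp [hy]
      rw [mvfderiv_congr_of_eventuallyEq this, mvfderiv_const]
    rw [this]
    change (0 : ℝ) • _ + (ρ p * ρ p) • _ = _
    simp [hp1]
  have h2 : ∀ l : W →L[ℝ] ℝ, mvfderiv 𝓘(ℝ, E) (cutoffCoord e ρ hρ s l) p u =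
      l (mvfderiv 𝓘(ℝ, E) (fun x => e.continuousLinearMapAt ℝ x (s x)) p u) := by
    intro l
    rw [← mvfderiv_clm_comp l hd]
    refine DFunLike.congr_fun (mvfderiv_congr_of_eventuallyEq ?_) u
    filter_upwards [hp] with y hy
    change ρ y * _ = _
    rw [hy, one_mul]
  rw [← h1, sq_smul_eq_sum_cutoffCoord_extendConst e ρ hρ s, map_sum]
  simp only [hT, h2]
  rw [Finset.sum_add_distrib]
  set b := Module.finBasis ℝ W
  congr 1
  · conv_rhs => rw [← b.sum_repr (mvfderiv 𝓘(ℝ, E) (fun x => e.continuousLinearMapAt ℝ x (s x)) p u)]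
    simp only [map_sum, map_smul]
    refine Finset.sum_congr rfl fun i _ => ?_
    rw [extendConst_apply, hp1, one_smul]
    rfl
  · conv_rhs => rw [← b.sum_repr (e.continuousLinearMapAt ℝ p (s p))]
    simp only [map_sum, map_smul]
    refine Finset.sum_congr rfl fun i _ => ?_
    change (ρ p * b.repr _ i) • _ = _
    rw [hp1, one_mul]

end Sections

/-! ### Flat connections and their connection forms. -/

section FlatConnection

open Topology Set Bundle

variable {E : Type*} [NormedAddCommGroup E] [NormedSpace ℝ E]
  {M : Type*} [TopologicalSpace M] [ChartedSpace E M]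

theorem mlieBracket_const (v w : E) (x : E) :
    VectorField.mlieBracket 𝓘(ℝ, E) (fun y => (v : TangentSpace 𝓘(ℝ, E) y))
      (fun y => (w : TangentSpace 𝓘(ℝ, E) y)) x = 0 := by
  refine (congrFun (VectorField.mlieBracketWithin_univ (I := 𝓘(ℝ, E))).symm x).trans
    ((congrFun VectorField.mlieBracketWithin_eq_lieBracketWithin x).trans ?_)
  simp [VectorField.lieBracketWithin]
  rfl

/-- Coordinate vector fields of a chart commute. -/
theorem mlieBracket_extendConst [CompleteSpace E] [IsManifold 𝓘(ℝ, E) ∞ M] {c p : M}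
    (ρ : C^∞⟮𝓘(ℝ, E), M; ℝ⟯)
    (hρ : tsupport ρ ⊆ (trivializationAt E (TangentSpace 𝓘(ℝ, E)) c).baseSet)
    (hp : ∀ᶠ y in 𝓝 p, ρ y = 1) (v w : E) :
    VectorField.mlieBracket 𝓘(ℝ, E)
      (fun y => extendConst (trivializationAt E (TangentSpace 𝓘(ℝ, E)) c) ρ hρ v y)
      (fun y => extendConst (trivializationAt E (TangentSpace 𝓘(ℝ, E)) c) ρ hρ w y) p = 0 := by
  have hM1 : IsManifold 𝓘(ℝ, E) 1 M := .of_le (n := ∞) (by simp)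
  have hM2 : IsManifold 𝓘(ℝ, E) (minSmoothness ℝ 2) M := .of_le (n := ∞) (by
    rw [minSmoothness_of_isRCLikeNormedField]
    exact WithTop.coe_le_coe.2 le_top)
  set φ := extChartAt 𝓘(ℝ, E) c
  -- Where `ρ = 1`, these fields are pullbacks of constant fields under the chart, and pullback
  -- commutes with the bracket.
  have key : ∀ v : E, (fun y => extendConst (trivializationAt E (TangentSpace 𝓘(ℝ, E)) c) ρ hρ v y)
      =ᶠ[𝓝 p] VectorField.mpullback 𝓘(ℝ, E) 𝓘(ℝ, E) φ (fun _ => v) := by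
    intro v
    filter_upwards [hp] with y hy
    have hye : y ∈ (trivializationAt E (TangentSpace 𝓘(ℝ, E)) c).baseSet :=
      hρ (subset_tsupport _ (by simp [hy]))
    have hyc : y ∈ (chartAt E c).source := by simpa using hye
    let L : TangentSpace 𝓘(ℝ, E) y ≃L[ℝ] TangentSpace 𝓘(ℝ, E) (φ y) :=
      (trivializationAt E (TangentSpace 𝓘(ℝ, E)) c).continuousLinearEquivAt ℝ y hye
    have h : mfderiv 𝓘(ℝ, E) 𝓘(ℝ, E) φ y = L :=
      (TangentBundle.continuousLinearMapAt_trivializationAt hyc).symm.trans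
        (DFunLike.coe_injective (Trivialization.coe_continuousLinearEquivAt_eq _ hye).symm)
    have h' : (mfderiv 𝓘(ℝ, E) 𝓘(ℝ, E) φ y).inverse = L.symm := by
      rw [h, ContinuousLinearMap.inverse_equiv]
    refine Eq.trans ?_ (DFunLike.congr_fun h' v).symm
    rw [extendConst_apply, hy, one_smul]
    exact (congrFun (Trivialization.symm_continuousLinearEquivAt_eq _ hye) v).symm
  have hpe : p ∈ (trivializationAt E (TangentSpace 𝓘(ℝ, E)) c).baseSet :=
      hρ (subset_tsupport _ (by simp [hp.self_of_nhds]))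
  have hpc : p ∈ (chartAt E c).source := by simpa using hpe
  have hc : ∀ v : E, MDifferentiableAt 𝓘(ℝ, E) (𝓘(ℝ, E).prod 𝓘(ℝ, E))
      (fun y => (⟨y, v⟩ : TangentBundle 𝓘(ℝ, E) E)) (φ p) := fun v => by
    refine ContMDiffAt.mdifferentiableAt (n := 1) ?_ (by simp)
    exact contMDiffAt_vectorSpace_iff_contDiffAt.2 contDiffAt_const
  rw [(key v).mlieBracket_vectorField_eq (key w),
    ← VectorField.mpullback_mlieBracket (n := ∞) (hc v) (hc w) ((contMDiffOn_extChartAt).contMDiffAt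
      ((chartAt E c).open_source.mem_nhds hpc)) (by
        rw [minSmoothness_of_isRCLikeNormedField]
        exact WithTop.coe_le_coe.2 le_top)]
  refine (congrArg _ (mlieBracket_const v w (φ p))).trans (map_zero _)

variable (E M) (W : Type*) [NormedAddCommGroup W] [NormedSpace ℝ W]
  (F : M → Type*) [TopologicalSpace (TotalSpace W F)]
  [∀ x, TopologicalSpace (F x)] [FiberBundle W F]
  [∀ x, AddCommGroup (F x)] [∀ x, Module ℝ (F x)] [VectorBundle ℝ W F]

/-- A flat connection, as an operator on smooth vector fields and smooth sections. -/
structure FlatConnection [IsManifold 𝓘(ℝ, E) ∞ M] where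
  /-- the covariant derivative -/
  cov : EvenField E M →ₗ[ℝ] OddField E M W F →ₗ[ℝ] OddField E M W F
  smul_left : ∀ f U s, cov (funSMul f U) s = funSMul f (cov U s)
  leibniz : ∀ U f s x, cov U (funSMul f s) x = U.act f x • s x + f x • cov U s x
  -- The smooth field `X` is part of the data, so smoothness of the pointwise bracket need not be
  -- proved separately; a super tangent bundle supplies it.
  flat : ∀ U V, ∃ X : EvenField E M,
    (∀ x, X x = VectorField.mlieBracket 𝓘(ℝ, E) (fun y => U y) (fun y => V y) x) ∧
      ∀ s, cov U (cov V s) = cov X s + cov V (cov U s)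

variable {E M W F}

/-- The value of a section at a point, as a linear map. -/
noncomputable def evalSection (x : M) : Cₛ^∞⟮𝓘(ℝ, E); W, F⟯ →ₗ[ℝ] F x where
  toFun s := s x
  map_add' _ _ := rfl
  map_smul' _ _ := rfl

@[simp]
theorem evalSection_apply (x : M) (s : Cₛ^∞⟮𝓘(ℝ, E); W, F⟯) : evalSection x s = s x := rfl

namespace FlatConnection

variable [IsManifold 𝓘(ℝ, E) ∞ M] (D : FlatConnection E M W F)
  {c : M} (ρ : C^∞⟮𝓘(ℝ, E), M; ℝ⟯)
  (hρ : tsupport ρ ⊆ (trivializationAt E (TangentSpace 𝓘(ℝ, E)) c).baseSet)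

/-- Linearity over functions in `U` makes `U ↦ D.cov U s p` a first order operator with zero symbol,
so only the value `U p` matters. -/
theorem cov_eq_cov_extendConst [FiniteDimensional ℝ E] {p : M} (hp : ∀ᶠ y in 𝓝 p, ρ y = 1)
    (U : EvenField E M)
    (s : OddField E M W F) : D.cov U s p =
      D.cov (extendConst (trivializationAt E (TangentSpace 𝓘(ℝ, E)) c) ρ hρ
        ((trivializationAt E (TangentSpace 𝓘(ℝ, E)) c).continuousLinearMapAt ℝ p (U p))) s p := by
  have h := eq_symbol_add_extendConst (trivializationAt E (TangentSpace 𝓘(ℝ, E)) c) ρ hρ hp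
    ((evalSection p).comp (D.cov.flip s)) 0 0 (fun f U => by simp [D.smul_left]) U
  simpa using h

/-- This disposes of the bracket term in the flatness identity: because of the cutoff, the bracket
of two extended coordinate fields is only known to vanish at points near which `ρ = 1`. -/
theorem cov_eq_zero_of_eq_zero [FiniteDimensional ℝ E] [T2Space M] {p : M} {U : EvenField E M}
    (hU : U p = 0) (s : OddField E M W F) : D.cov U s p = 0 := by
  obtain ⟨ρ, hp, hρ⟩ := exists_contMDiffMap_eventuallyEq_one (E := E)
    ((trivializationAt E (TangentSpace 𝓘(ℝ, E)) p).open_baseSet.mem_nhds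
      (mem_baseSet_trivializationAt E (TangentSpace 𝓘(ℝ, E)) p))
  rw [D.cov_eq_cov_extendConst ρ hρ hp, hU]
  simp only [map_zero]
  rfl

variable [ContMDiffVectorBundle ∞ W F 𝓘(ℝ, E)]
  (e : Trivialization W (TotalSpace.proj : TotalSpace W F → M)) [MemTrivializationAtlas e]
  (hρe : tsupport ρ ⊆ e.baseSet)

/-- The connection form at a point with respect to a chart and a trivialization. -/
noncomputable def form [FiniteDimensional ℝ E] [FiniteDimensional ℝ W] (x : M) :
    E →L[ℝ] W →L[ℝ] W :=
  LinearMap.toContinuousLinearMap ((LinearMap.toContinuousLinearMap :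
      (W →ₗ[ℝ] W) ≃ₗ[ℝ] (W →L[ℝ] W)).toLinearMap.comp
    (((D.cov.compl₁₂ (extendConst (trivializationAt E (TangentSpace 𝓘(ℝ, E)) c) ρ hρ)
      (extendConst e ρ hρe)).compr₂ (evalSection x)).compr₂
        (e.continuousLinearMapAt ℝ x).toLinearMap))

theorem form_apply [FiniteDimensional ℝ E] [FiniteDimensional ℝ W] (x : M) (v : E) (w : W) :
    D.form ρ hρ e hρe x v w = e.continuousLinearMapAt ℝ x
      (D.cov (extendConst (trivializationAt E (TangentSpace 𝓘(ℝ, E)) c) ρ hρ v)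
        (extendConst e ρ hρe w) x) := rfl

variable [FiniteDimensional ℝ E] [FiniteDimensional ℝ W]

/-- The covariant derivative in a trivialization is `d + A`. -/
theorem continuousLinearMapAt_cov {p : M} (hp : ∀ᶠ y in 𝓝 p, ρ y = 1) (U : EvenField E M)
    (s : OddField E M W F) :
    e.continuousLinearMapAt ℝ p (D.cov U s p) =
      mvfderiv 𝓘(ℝ, E) (fun x => e.continuousLinearMapAt ℝ x (s x)) p (U p) +
      D.form ρ hρ e hρe p
        ((trivializationAt E (TangentSpace 𝓘(ℝ, E)) c).continuousLinearMapAt ℝ p (U p))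
        (e.continuousLinearMapAt ℝ p (s p)) := by
  have hpe : p ∈ e.baseSet := hρe (subset_tsupport _ (by simp [hp.self_of_nhds]))
  have h := eq_symbol_add_extendConst e ρ hρe hp ((evalSection p).comp (D.cov U))
    LinearMap.id (U p) (fun f s => D.leibniz U f s p) s
  rw [LinearMap.comp_apply, evalSection_apply] at h
  rw [h, map_add, LinearMap.id_apply, e.continuousLinearMapAt_symmL hpe, LinearMap.comp_apply,
    evalSection_apply, D.form_apply, D.cov_eq_cov_extendConst ρ hρ hp]

theorem contMDiffOn_form (v : E) (w : W) :
    ContMDiffOn 𝓘(ℝ, E) 𝓘(ℝ, W) ∞ (fun x => D.form ρ hρ e hρe x v w) e.baseSet :=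
  (contMDiffOn_continuousLinearMapAt_section e e.open_baseSet subset_rfl).1
    (D.cov _ _).contMDiff.contMDiffOn

/-- The structure equation of a flat connection, in a chart and a trivialization. -/
theorem form_flat [T2Space M] {p : M} (hp : ∀ᶠ y in 𝓝 p, ρ y = 1) (v w : E) (z : W) :
    mvfderiv 𝓘(ℝ, E) (fun x => D.form ρ hρ e hρe x w z) p
        ((trivializationAt E (TangentSpace 𝓘(ℝ, E)) c).symmL ℝ p v) +
      D.form ρ hρ e hρe p v (D.form ρ hρ e hρe p w z) =
    mvfderiv 𝓘(ℝ, E) (fun x => D.form ρ hρ e hρe x v z) p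
        ((trivializationAt E (TangentSpace 𝓘(ℝ, E)) c).symmL ℝ p w) +
      D.form ρ hρ e hρe p w (D.form ρ hρ e hρe p v z) := by
  have hc : CompleteSpace E := FiniteDimensional.complete ℝ E
  -- Apply the formula `d + A` to the section `∇_w z`, whose coordinates are `A(w) z` by definition
  -- of `form`. The claim becomes symmetry of the second covariant derivative in `v` and `w`.
  have key : ∀ v w : E, e.continuousLinearMapAt ℝ p
      (D.cov (extendConst (trivializationAt E (TangentSpace 𝓘(ℝ, E)) c) ρ hρ v)
        (D.cov (extendConst (trivializationAt E (TangentSpace 𝓘(ℝ, E)) c) ρ hρ w)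
          (extendConst e ρ hρe z)) p) =
      mvfderiv 𝓘(ℝ, E) (fun x => D.form ρ hρ e hρe x w z) p
        ((trivializationAt E (TangentSpace 𝓘(ℝ, E)) c).symmL ℝ p v) +
      D.form ρ hρ e hρe p v (D.form ρ hρ e hρe p w z) := by
    intro v w
    rw [D.continuousLinearMapAt_cov ρ hρ e hρe hp,
      continuousLinearMapAt_extendConst _ ρ hρ hp.self_of_nhds, extendConst_apply,
      hp.self_of_nhds, one_smul]
    rfl
  rw [← key, ← key]
  obtain ⟨X, hX, h⟩ := D.flat (extendConst (trivializationAt E (TangentSpace 𝓘(ℝ, E)) c) ρ hρ v)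
    (extendConst (trivializationAt E (TangentSpace 𝓘(ℝ, E)) c) ρ hρ w)
  rw [h]
  have h0 : D.cov X (extendConst e ρ hρe z) p = 0 :=
    D.cov_eq_zero_of_eq_zero (by rw [hX, mlieBracket_extendConst ρ hρ hp]) _
  congr 1
  change D.cov X _ p + _ = _
  rw [h0, zero_add]

end FlatConnection

end FlatConnection

/-! ### Local parallel frames. -/

section ParallelFrame

open Topology Set Bundle

variable {E : Type*} [NormedAddCommGroup E] [NormedSpace ℝ E]
  {M : Type*} [TopologicalSpace M] [ChartedSpace E M] [IsManifold 𝓘(ℝ, E) ∞ M]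
  {W : Type*} [NormedAddCommGroup W] [NormedSpace ℝ W]
  {F : M → Type*} [TopologicalSpace (TotalSpace W F)]
  [∀ x, TopologicalSpace (F x)] [FiberBundle W F]
  [∀ x, AddCommGroup (F x)] [∀ x, Module ℝ (F x)] [VectorBundle ℝ W F]

/-- A smooth frame over an open set which is parallel for a flat connection. Outside of the set the
identifications are arbitrary. -/
structure FlatConnection.ParallelFrame (D : FlatConnection E M W F) where
  domain : Set M
  isOpen_domain : IsOpen domain
  equiv : ∀ x, F x ≃ₗ[ℝ] W
  contMDiffOn : ContMDiffOn (𝓘(ℝ, E).prod 𝓘(ℝ, W)) 𝓘(ℝ, W) ∞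
    (fun z : TotalSpace W F => equiv z.1 z.2) (TotalSpace.proj ⁻¹' domain)
  contMDiffOn_symm : ContMDiffOn (𝓘(ℝ, E).prod 𝓘(ℝ, W)) (𝓘(ℝ, E).prod 𝓘(ℝ, W)) ∞
    (fun q : M × W => TotalSpace.mk' W q.1 ((equiv q.1).symm q.2)) (domain ×ˢ univ)
  equiv_cov : ∀ x ∈ domain, ∀ U s,
    equiv x (D.cov U s x) = mvfderiv 𝓘(ℝ, E) (fun y => equiv y (s y)) x (U x)

variable [FiniteDimensional ℝ E] [FiniteDimensional ℝ W] [T2Space M]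
  [ContMDiffVectorBundle ∞ W F 𝓘(ℝ, E)]

/-- The connection form in the chart at `c` of a flat connection is locally a pure gauge. -/
theorem FlatConnection.exists_gauge (D : FlatConnection E M W F) {c : M}
    (e : Trivialization W (TotalSpace.proj : TotalSpace W F → M)) [MemTrivializationAtlas e]
    (ρ : C^∞⟮𝓘(ℝ, E), M; ℝ⟯) (hc : ∀ᶠ y in 𝓝 c, ρ y = 1)
    (hρ : tsupport ρ ⊆ (trivializationAt E (TangentSpace 𝓘(ℝ, E)) c).baseSet)
    (hρe : tsupport ρ ⊆ e.baseSet) :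
    ∃ U : Set M, IsOpen U ∧ c ∈ U ∧ U ⊆ (chartAt E c).source ∧
      (∀ x ∈ U, ∀ᶠ y in 𝓝 x, ρ y = 1) ∧
      ∃ (B : Set E) (P : E → W →L[ℝ] W), IsOpen B ∧ MapsTo (extChartAt 𝓘(ℝ, E) c) U B ∧
        ContDiffOn ℝ ∞ P B ∧ ∀ x ∈ U, IsUnit (P (extChartAt 𝓘(ℝ, E) c x)) ∧
          HasFDerivAt P ((ContinuousLinearMap.mul ℝ (W →L[ℝ] W)
            (P (extChartAt 𝓘(ℝ, E) c x))).comp (D.form ρ hρ e hρe x))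
            (extChartAt 𝓘(ℝ, E) c x) := by
  have hW : CompleteSpace W := FiniteDimensional.complete ℝ W
  set φ := extChartAt 𝓘(ℝ, E) c with hφ
  set N := interior {x | ρ x = 1}
  have hN : ∀ x ∈ N, ∀ᶠ y in 𝓝 x, ρ y = 1 := fun x hx => mem_interior_iff_mem_nhds.1 hx
  have hNe : N ⊆ e.baseSet := fun x hx => hρe (subset_tsupport _ (by
    simp [(hN x hx).self_of_nhds]))
  have hΩ : IsOpen (φ.target ∩ φ.symm ⁻¹' N) :=
    (continuousOn_extChartAt_symm c).isOpen_inter_preimage (isOpen_extChartAt_target c)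
      isOpen_interior
  have hcs : c ∈ φ.source := mem_extChartAt_source c
  have hcΩ : φ c ∈ φ.target ∩ φ.symm ⁻¹' N := by
    refine ⟨φ.map_source hcs, ?_⟩
    rw [mem_preimage, φ.left_inv hcs]
    exact mem_interior_iff_mem_nhds.2 hc
  have hA1 : ∀ v w, ContDiffOn ℝ ∞ (fun y => D.form ρ hρ e hρe (φ.symm y) v w)
      (φ.target ∩ φ.symm ⁻¹' N) := fun v w => by
    refine contMDiffOn_iff_contDiffOn.1 ?_
    exact (D.contMDiffOn_form ρ hρ e hρe v w).comp
      ((contMDiffOn_extChartAt_symm c).mono inter_subset_left) fun y hy => hNe hy.2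
  have hA : ContDiffOn ℝ ∞ (fun y => D.form ρ hρ e hρe (φ.symm y)) (φ.target ∩ φ.symm ⁻¹' N) :=
    contDiffOn_clm_apply.2 fun v => contDiffOn_clm_apply.2 fun w => hA1 v w
  -- This carries the structure equation `form_flat` from the manifold to the chart, where
  -- `exists_gauge_of_flat` applies.
  have hderiv : ∀ y ∈ φ.target ∩ φ.symm ⁻¹' N, ∀ v w z,
      fderiv ℝ (fun y => D.form ρ hρ e hρe (φ.symm y)) y v w z =
        mvfderiv 𝓘(ℝ, E) (fun x => D.form ρ hρ e hρe x w z) (φ.symm y)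
          ((trivializationAt E (TangentSpace 𝓘(ℝ, E)) c).symmL ℝ (φ.symm y) v) := by
    intro y hy v w z
    have hd : DifferentiableAt ℝ (fun y => D.form ρ hρ e hρe (φ.symm y)) y :=
      (hA.contDiffAt (hΩ.mem_nhds hy)).differentiableAt (by simp)
    have hys : φ.symm y ∈ (chartAt E c).source := by
      rw [← extChartAt_source 𝓘(ℝ, E)]
      exact φ.map_target hy.1
    have hyb : φ.symm y ∈ (trivializationAt E (TangentSpace 𝓘(ℝ, E)) c).baseSet := by
      simpa using hys
    rw [mvfderiv_eq_fderiv_comp_symm hys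
      (((D.contMDiffOn_form ρ hρ e hρe w z).contMDiffAt
        (e.open_baseSet.mem_nhds (hNe hy.2))).mdifferentiableAt (by simp)),
      Trivialization.continuousLinearMapAt_symmL _ hyb, ← hφ, φ.right_inv hy.1]
    exact (DFunLike.congr_fun (hasFDerivAt_clm_apply_const
      (hasFDerivAt_clm_apply_const hd.hasFDerivAt w) z).fderiv v).symm
  obtain ⟨r, hr, hrΩ, P, hP, hPx⟩ := exists_gauge_of_flat (R := W →L[ℝ] W)
    (hΩ.mem_nhds hcΩ) hA (fun y hy v w => by
      ext z
      have := D.form_flat ρ hρ e hρe (hN _ hy.2) v w z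
      rw [← hderiv y hy, ← hderiv y hy] at this
      exact this)
  refine ⟨φ.source ∩ φ ⁻¹' Metric.ball (φ c) r,
    (continuousOn_extChartAt c).isOpen_inter_preimage (isOpen_extChartAt_source c)
      Metric.isOpen_ball, ⟨hcs, Metric.mem_ball_self hr⟩, fun x hx => by
        simpa [hφ] using hx.1, fun x hx => hN x ?_, Metric.ball (φ c) r, P, Metric.isOpen_ball,
      fun x hx => hx.2, hP, fun x hx => ?_⟩
  · have := (hrΩ hx.2).2
    rwa [mem_preimage, φ.left_inv hx.1] at this
  · have := hPx _ hx.2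
    rwa [φ.left_inv hx.1] at this

/-- The frame is the trivialization followed by the gauge `P`; it is parallel because `d(P s) = P
(ds + A s)` when `dP = P A`. -/
theorem FlatConnection.exists_parallelFrame (D : FlatConnection E M W F) (c : M) :
    ∃ f : D.ParallelFrame, c ∈ f.domain := by
  have hW : CompleteSpace W := FiniteDimensional.complete ℝ W
  set e := trivializationAt W F c
  obtain ⟨ρ, hc, hρ'⟩ := exists_contMDiffMap_eventuallyEq_one (E := E) (x := c) (Filter.inter_mem
    ((trivializationAt E (TangentSpace 𝓘(ℝ, E)) c).open_baseSet.mem_nhds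
      (mem_baseSet_trivializationAt E (TangentSpace 𝓘(ℝ, E)) c))
    (e.open_baseSet.mem_nhds (mem_baseSet_trivializationAt W F c)))
  have hρ := hρ'.trans inter_subset_left
  have hρe := hρ'.trans inter_subset_right
  obtain ⟨U, hU, hcU, hUs, hU1, B, P, hB, hUB, hP, hPx⟩ := D.exists_gauge e ρ hc hρ hρe
  set φ := extChartAt 𝓘(ℝ, E) c with hφ
  have hUe : U ⊆ e.baseSet := fun x hx => hρe (subset_tsupport _ (by
    simp [(hU1 x hx).self_of_nhds]))
  have hex : ∀ x, ∃ ψ : F x ≃ₗ[ℝ] W,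
      x ∈ U → ∀ v, ψ v = P (φ x) (e.continuousLinearMapAt ℝ x v) := by
    intro x
    by_cases hx : x ∈ U
    · obtain ⟨u, hu⟩ := (hPx x hx).1
      refine ⟨((e.continuousLinearEquivAt ℝ x (hUe hx)).trans
        (ContinuousLinearEquiv.ofUnit u)).toLinearEquiv, fun _ v => ?_⟩
      rw [← hu, ← e.coe_continuousLinearEquivAt_eq (R := ℝ) (hUe hx)]
      rfl
    · exact ⟨((trivializationAt W F x).continuousLinearEquivAt ℝ x
        (mem_baseSet_trivializationAt W F x)).toLinearEquiv, fun h => absurd h hx⟩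
  choose ψ hψ using hex
  have hψs : ∀ x ∈ U, ∀ w, (ψ x).symm w = e.symmL ℝ x (Ring.inverse (P (φ x)) w) := by
    intro x hx w
    rw [LinearEquiv.symm_apply_eq, hψ x hx, e.continuousLinearMapAt_symmL (hUe hx)]
    exact (DFunLike.congr_fun (Ring.mul_inverse_cancel _ (hPx x hx).1) w).symm
  have hPφ : ContMDiffOn 𝓘(ℝ, E) 𝓘(ℝ, W →L[ℝ] W) ∞ (fun x => P (φ x)) U :=
    hP.contMDiffOn.comp (contMDiffOn_extChartAt.mono hUs) hUB
  -- Inversion is smooth at units of the Banach algebra `W →L[ℝ] W`; this gives smoothness of the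
  -- inverse frame.
  have hPi : ContMDiffOn 𝓘(ℝ, E) 𝓘(ℝ, W →L[ℝ] W) ∞ (fun x => Ring.inverse (P (φ x))) U := by
    intro x hx
    obtain ⟨u, hu⟩ := (hPx x hx).1
    have h : ContMDiffAt 𝓘(ℝ, W →L[ℝ] W) 𝓘(ℝ, W →L[ℝ] W) ∞ Ring.inverse (P (φ x)) := by
      rw [← hu]
      exact (contDiffAt_ringInverse ℝ u).contMDiffAt
    exact h.comp_contMDiffWithinAt x (hPφ x hx)
  refine ⟨⟨U, hU, ψ, ?_, ?_, fun x hx V s => ?_⟩, hcU⟩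
  · have h1 : ContMDiffOn (𝓘(ℝ, E).prod 𝓘(ℝ, W)) 𝓘(ℝ, W) ∞
        (fun z : TotalSpace W F => P (φ z.1) (e z).2) (TotalSpace.proj ⁻¹' U) := by
      refine ContMDiffOn.clm_apply (hPφ.comp (contMDiff_proj F).contMDiffOn fun z hz => hz) ?_
      refine ContMDiffOn.mono ?_ (fun z hz => e.mem_source.2 (hUe hz))
      exact contMDiff_snd.comp_contMDiffOn e.contMDiffOn
    refine h1.congr fun z hz => ?_
    rw [hψ _ hz, Trivialization.continuousLinearMapAt_apply,
      Trivialization.coe_linearMapAt_of_mem e (hUe hz)]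
  · have hmaps : MapsTo (fun q : M × W => TotalSpace.mk' W q.1 ((ψ q.1).symm q.2)) (U ×ˢ univ)
        e.source := fun q hq => e.mem_source.2 (hUe hq.1)
    rw [e.contMDiffOn_iff hmaps]
    refine ⟨contMDiffOn_fst, ?_⟩
    have h1 : ContMDiffOn (𝓘(ℝ, E).prod 𝓘(ℝ, W)) 𝓘(ℝ, W) ∞
        (fun q : M × W => Ring.inverse (P (φ q.1)) q.2) (U ×ˢ univ) :=
      ContMDiffOn.clm_apply (hPi.comp contMDiffOn_fst fun q hq => hq.1) contMDiffOn_snd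
    refine h1.congr fun q hq => ?_
    rw [hψs _ hq.1]
    change (e ⟨q.1, _⟩).2 = _
    have := e.continuousLinearMapAt_symmL (R := ℝ) (hUe hq.1) (Ring.inverse (P (φ q.1)) q.2)
    rwa [Trivialization.continuousLinearMapAt_apply,
      Trivialization.coe_linearMapAt_of_mem e (hUe hq.1)] at this
  · have hxs : x ∈ φ.source := by rw [hφ, extChartAt_source]; exact hUs hx
    have hsd : MDifferentiableAt 𝓘(ℝ, E) 𝓘(ℝ, W)
        (fun x => e.continuousLinearMapAt ℝ x (s x)) x :=
      (((contMDiffOn_continuousLinearMapAt_section e e.open_baseSet subset_rfl).1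
        s.contMDiff.contMDiffOn).contMDiffAt (e.open_baseSet.mem_nhds (hUe hx))).mdifferentiableAt
          (by simp)
    have hcongr : (fun y => ψ y (s y)) =ᶠ[𝓝 x]
        fun y => P (φ y) (e.continuousLinearMapAt ℝ y (s y)) := by
      filter_upwards [hU.mem_nhds hx] with y hy using hψ y hy _
    have hd : MDifferentiableAt 𝓘(ℝ, E) 𝓘(ℝ, W)
        (fun y => P (φ y) (e.continuousLinearMapAt ℝ y (s y))) x :=
      (((hPφ.contMDiffAt (hU.mem_nhds hx)).mdifferentiableAt (by simp)).clm_apply hsd)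
    rw [hψ x hx, D.continuousLinearMapAt_cov ρ hρ e hρe (hU1 x hx),
      mvfderiv_congr_of_eventuallyEq hcongr, mvfderiv_eq_fderiv_comp_symm (hUs hx) hd,
      mvfderiv_eq_fderiv_comp_symm (hUs hx) hsd, ← hφ]
    have hloc : (fun y => P (φ y) (e.continuousLinearMapAt ℝ y (s y))) ∘ φ.symm =ᶠ[𝓝 (φ x)]
        fun y => P y (((fun x => e.continuousLinearMapAt ℝ x (s x)) ∘ φ.symm) y) := by
      filter_upwards [(isOpen_extChartAt_target c).mem_nhds (φ.map_source hxs)] with y hy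
      simp only [Function.comp_apply]
      rw [φ.right_inv hy]
    rw [hloc.fderiv_eq, ((hPx x hx).2.clm_apply
      (differentiableAt_comp_extChartAt_symm (hUs hx) hsd).hasFDerivAt).fderiv]
    have hσ : ((fun x => e.continuousLinearMapAt ℝ x (s x)) ∘ φ.symm) (φ x) =
        e.continuousLinearMapAt ℝ x (s x) := by
      simp only [Function.comp_apply]
      rw [φ.left_inv hxs]
    rw [map_add]
    simp only [_root_.add_apply, ContinuousLinearMap.comp_apply, ContinuousLinearMap.flip_apply,
      ContinuousLinearMap.mul_apply']
    congr 1
    exact congrArg (fun z => P (φ x) (D.form ρ hρ e hρe x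
      ((trivializationAt E (TangentSpace 𝓘(ℝ, E)) c).continuousLinearMapAt ℝ x (V x)) z)) hσ.symm

end ParallelFrame

/-! ### Comparison of parallel frames and the global frame. -/

section GlobalFrame

open Topology Set Bundle

variable {E : Type*} [NormedAddCommGroup E] [NormedSpace ℝ E]
  {M : Type*} [TopologicalSpace M] [ChartedSpace E M] [IsManifold 𝓘(ℝ, E) ∞ M]
  {W : Type*} [NormedAddCommGroup W] [NormedSpace ℝ W]

theorem eventually_eq_of_eventually_mvfderiv_eq_zero {g : M → W} {x : M}
    (h : ∀ᶠ y in 𝓝 x, MDifferentiableAt 𝓘(ℝ, E) 𝓘(ℝ, W) g y ∧ mvfderiv 𝓘(ℝ, E) g y = 0) :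
    ∀ᶠ y in 𝓝 x, g y = g x := by
  set φ := extChartAt 𝓘(ℝ, E) x with hφ
  have hxs : x ∈ φ.source := mem_extChartAt_source x
  have h1 : ∀ᶠ y in 𝓝 (φ x), y ∈ φ.target ∧
      MDifferentiableAt 𝓘(ℝ, E) 𝓘(ℝ, W) g (φ.symm y) ∧ mvfderiv 𝓘(ℝ, E) g (φ.symm y) = 0 := by
    refine Filter.Eventually.and ((isOpen_extChartAt_target x).mem_nhds (φ.map_source hxs)) ?_
    refine Filter.Tendsto.eventually (p := fun z => MDifferentiableAt 𝓘(ℝ, E) 𝓘(ℝ, W) g z ∧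
      mvfderiv 𝓘(ℝ, E) g z = 0) (continuousAt_extChartAt_symm (I := 𝓘(ℝ, E)) x) ?_
    rwa [← hφ, φ.left_inv hxs]
  obtain ⟨r, hr, hball⟩ := Metric.mem_nhds_iff.1 h1
  have hd : ∀ y ∈ Metric.ball (φ x) r, DifferentiableAt ℝ (g ∘ φ.symm) y ∧
      fderiv ℝ (g ∘ φ.symm) y = 0 := by
    intro y hy
    obtain ⟨hyt, hyd, hy0⟩ := hball hy
    have hys : φ.symm y ∈ (chartAt E x).source := by
      rw [← extChartAt_source 𝓘(ℝ, E)]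
      exact φ.map_target hyt
    have hyb : φ.symm y ∈ (trivializationAt E (TangentSpace 𝓘(ℝ, E)) x).baseSet := by
      simpa using hys
    have e1 := differentiableAt_comp_extChartAt_symm hys hyd
    rw [← hφ, φ.right_inv hyt] at e1
    refine ⟨e1, ContinuousLinearMap.ext fun v => ?_⟩
    have e2 := mvfderiv_eq_fderiv_comp_symm hys hyd
      ((trivializationAt E (TangentSpace 𝓘(ℝ, E)) x).symmL ℝ (φ.symm y) v)
    rw [Trivialization.continuousLinearMapAt_symmL _ hyb, ← hφ, φ.right_inv hyt, hy0] at e2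
    exact e2.symm
  have hball' : ∀ᶠ y in 𝓝 x, y ∈ φ.source ∧ φ y ∈ Metric.ball (φ x) r :=
    Filter.Eventually.and ((isOpen_extChartAt_source x).mem_nhds hxs)
      ((continuousAt_extChartAt (I := 𝓘(ℝ, E)) x).eventually (Metric.ball_mem_nhds _ hr))
  filter_upwards [hball'] with y hy
  have := Metric.isOpen_ball.is_const_of_fderiv_eq_zero (𝕜 := ℝ)
    (convex_ball (φ x) r).isPreconnected
    (fun y hy => (hd y hy).1.differentiableWithinAt) (fun y hy => (hd y hy).2) hy.2
    (Metric.mem_ball_self hr)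
  simpa only [Function.comp_apply, φ.left_inv hy.1, φ.left_inv hxs] using this

variable {F : M → Type*} [TopologicalSpace (TotalSpace W F)]
  [∀ x, TopologicalSpace (F x)] [FiberBundle W F]
  [∀ x, AddCommGroup (F x)] [∀ x, Module ℝ (F x)] [VectorBundle ℝ W F]

/-- Connections act on global fields only; to test a derivative on a single tangent vector, that
vector is first extended to a field. -/
theorem exists_section_apply_eq [FiniteDimensional ℝ E] [T2Space M]
    [ContMDiffVectorBundle ∞ W F 𝓘(ℝ, E)] (x : M) (v : F x) :
    ∃ s : Cₛ^∞⟮𝓘(ℝ, E); W, F⟯, s x = v := by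
  obtain ⟨ρ, hx, hρ⟩ := exists_contMDiffMap_eventuallyEq_one (E := E)
    ((trivializationAt W F x).open_baseSet.mem_nhds (mem_baseSet_trivializationAt W F x))
  refine ⟨extendConst (trivializationAt W F x) ρ hρ
    ((trivializationAt W F x).continuousLinearMapAt ℝ x v), ?_⟩
  rw [extendConst_apply, hx.self_of_nhds, one_smul,
    Trivialization.symmL_continuousLinearMapAt _ (mem_baseSet_trivializationAt W F x)]

namespace FlatConnection.ParallelFrame

variable {D : FlatConnection E M W F}

theorem contMDiffOn_section (f : D.ParallelFrame) (s : OddField E M W F) :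
    ContMDiffOn 𝓘(ℝ, E) 𝓘(ℝ, W) ∞ (fun y => f.equiv y (s y)) f.domain :=
  f.contMDiffOn.comp s.contMDiff.contMDiffOn fun _ hy => hy

variable [FiniteDimensional ℝ E] [T2Space M]

/-- A section which is constant in a parallel frame has constant coordinates in every other. -/
theorem eventually_equiv_symm_eq (f g : D.ParallelFrame) {x : M} (hx : x ∈ f.domain ∩ g.domain)
    (w : W) : ∀ᶠ y in 𝓝 x, g.equiv y ((f.equiv y).symm w) = g.equiv x ((f.equiv x).symm w) := by
  obtain ⟨ρ, hρ1, hρ⟩ := exists_contMDiffMap_eventuallyEq_one (E := E)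
    (f.isOpen_domain.mem_nhds hx.1)
  -- Near `x` this section has constant coordinate `w` in `f`, so it is parallel there; its
  -- coordinates in `g` then have zero derivative.
  let s : OddField E M W F := cutoffSection ρ (fun y => (f.equiv y).symm w) f.domain
    f.isOpen_domain hρ (f.contMDiffOn_symm.comp (contMDiff_id.prodMk contMDiff_const).contMDiffOn
      fun y hy => ⟨hy, mem_univ _⟩)
  have hs : ∀ y, s y = ρ y • (f.equiv y).symm w := fun _ => rfl
  have hg : ∀ᶠ y in 𝓝 x, g.equiv y (s y) = g.equiv x (s x) := by
    refine eventually_eq_of_eventually_mvfderiv_eq_zero (E := E) ?_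
    filter_upwards [hρ1.eventually_nhds, f.isOpen_domain.mem_nhds hx.1,
      g.isOpen_domain.mem_nhds hx.2] with y hy hyf hyg
    refine ⟨((g.contMDiffOn_section s).contMDiffAt
      (g.isOpen_domain.mem_nhds hyg)).mdifferentiableAt (by simp), ?_⟩
    ext u
    obtain ⟨V, rfl⟩ := exists_section_apply_eq (E := E) (W := E)
      (F := (TangentSpace 𝓘(ℝ, E) : M → Type _)) y u
    have h0 : f.equiv y (D.cov V s y) = 0 := by
      rw [f.equiv_cov y hyf]
      have : (fun z => f.equiv z (s z)) =ᶠ[𝓝 y] fun _ => w := by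
        filter_upwards [hy] with z hz
        rw [hs, hz, one_smul, LinearEquiv.apply_symm_apply]
      rw [mvfderiv_congr_of_eventuallyEq this, mvfderiv_const]
      rfl
    rw [← g.equiv_cov y hyg, (LinearEquiv.map_eq_zero_iff _).1 h0, map_zero]
    rfl
  filter_upwards [hg, hρ1] with y hy hy1
  rwa [hs, hs, hy1, hρ1.self_of_nhds, one_smul, one_smul] at hy

variable [FiniteDimensional ℝ W]

/-- Finite rank matters here: the neighbourhoods on which the images of the basis vectors are
constant have to be intersected. -/
theorem eventually_transition_eq (f g : D.ParallelFrame) {x : M} (hx : x ∈ f.domain ∩ g.domain) :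
    ∀ᶠ y in 𝓝 x, (f.equiv y).symm.trans (g.equiv y) = (f.equiv x).symm.trans (g.equiv x) := by
  have h := Filter.eventually_all.2 fun i =>
    f.eventually_equiv_symm_eq g hx (Module.finBasis ℝ W i)
  filter_upwards [h] with y hy
  exact (Module.finBasis ℝ W).ext' hy

end FlatConnection.ParallelFrame

/-- A flat connection over a simply connected manifold has a global parallel frame. -/
theorem FlatConnection.exists_parallelFrame_univ [FiniteDimensional ℝ E] [T2Space M]
    [SimplyConnectedSpace M] [FiniteDimensional ℝ W] [ContMDiffVectorBundle ∞ W F 𝓘(ℝ, E)]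
    (D : FlatConnection E M W F) : ∃ f : D.ParallelFrame, f.domain = univ := by
  have : LocallyPathConnectedSpace M := ChartedSpace.locallyPathConnectedSpace E M
  choose fr hfr using D.exists_parallelFrame
  obtain ⟨s, hs1, hs2⟩ := exists_coboundary_of_locallyConstant_cocycle
    (fun i => (fr i).domain) (fun i => (fr i).isOpen_domain) id hfr
    (fun i j x => ((fr i).equiv x).symm.trans ((fr j).equiv x))
    (fun i j x hx => (fr i).eventually_transition_eq (fr j) hx)
    (fun i x _ => LinearEquiv.ext fun w => by simp)
    (fun i j k x _ => LinearEquiv.ext fun w => by simp [LinearEquiv.mul_apply])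
  -- Writing `f_i` for the frames, `T i j = f_j f_i⁻¹`, and `s_j = T i j s_i` says that `s_i⁻¹ f_i`
  -- does not depend on `i`. So near each point `Φ` is one local frame followed by a fixed
  -- automorphism of `W`, hence smooth and parallel.
  let Φ : ∀ x, F x ≃ₗ[ℝ] W := fun x => ((fr x).equiv x).trans (s x x)⁻¹
  have key : ∀ x, ∃ A : W ≃L[ℝ] W, ∀ᶠ y in 𝓝 x, y ∈ (fr x).domain ∧
      (∀ v, Φ y v = A ((fr x).equiv y v)) ∧ ∀ w, (Φ y).symm w = ((fr x).equiv y).symm (A.symm w) := by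
    intro x
    refine ⟨(s x x)⁻¹.toContinuousLinearEquiv, ?_⟩
    filter_upwards [hs1 x x (hfr x), (fr x).isOpen_domain.mem_nhds (hfr x)] with y hy hyx
    have h1 : ∀ v, Φ y v = (s x x)⁻¹ ((fr x).equiv y v) := by
      intro v
      have h2 := hs2 x y y ⟨hyx, hfr y⟩
      change (s y y)⁻¹ ((fr y).equiv y v) = _
      rw [← hy, h2, mul_inv_rev, LinearEquiv.mul_apply]
      congr 1
      change ((fr x).equiv y) (((fr y).equiv y).symm ((fr y).equiv y v)) = _
      rw [LinearEquiv.symm_apply_apply]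
    refine ⟨hyx, h1, fun w => ?_⟩
    rw [LinearEquiv.symm_apply_eq, h1, LinearEquiv.apply_symm_apply]
    exact ((s x x)⁻¹.apply_symm_apply w).symm
  choose A hA using key
  refine ⟨⟨univ, isOpen_univ, Φ, ?_, ?_, ?_⟩, rfl⟩
  · rw [preimage_univ, contMDiffOn_univ]
    intro z
    have h1 : ContMDiffAt (𝓘(ℝ, E).prod 𝓘(ℝ, W)) 𝓘(ℝ, W) ∞
        (fun y : TotalSpace W F => A z.1 ((fr z.1).equiv y.1 y.2)) z :=
      (A z.1).contDiff.contMDiff.contMDiffAt.comp z ((fr z.1).contMDiffOn.contMDiffAt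
        (((fr z.1).isOpen_domain.preimage (FiberBundle.continuous_proj W F)).mem_nhds (hfr z.1)))
    refine h1.congr_of_eventuallyEq ?_
    filter_upwards [(FiberBundle.continuous_proj W F).continuousAt.eventually (hA z.1)] with y hy
    exact hy.2.1 _
  · rw [univ_prod_univ, contMDiffOn_univ]
    intro q
    have h1 : ContMDiffAt (𝓘(ℝ, E).prod 𝓘(ℝ, W)) (𝓘(ℝ, E).prod 𝓘(ℝ, W)) ∞ (fun p : M × W =>
        TotalSpace.mk' W p.1 (((fr q.1).equiv p.1).symm ((A q.1).symm p.2))) q :=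
      ContMDiffAt.comp q (I' := 𝓘(ℝ, E).prod 𝓘(ℝ, W)) (f := fun p : M × W => (p.1, (A q.1).symm p.2))
        (g := fun p : M × W => TotalSpace.mk' W p.1 (((fr q.1).equiv p.1).symm p.2))
        ((fr q.1).contMDiffOn_symm.contMDiffAt (((fr q.1).isOpen_domain.prod isOpen_univ).mem_nhds
          ⟨hfr q.1, mem_univ _⟩))
        (contMDiffAt_fst.prodMk
          ((A q.1).symm.contDiff.contMDiff.contMDiffAt.comp q contMDiffAt_snd))
    refine h1.congr_of_eventuallyEq ?_
    filter_upwards [continuousAt_fst.eventually (hA q.1)] with p hp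
    rw [hp.2.2]
  · intro x _ U t
    have h1 : (fun y => Φ y (t y)) =ᶠ[𝓝 x]
        fun y => (A x : W →L[ℝ] W) ((fr x).equiv y (t y)) := by
      filter_upwards [hA x] with y hy using hy.2.1 _
    rw [mvfderiv_congr_of_eventuallyEq h1, mvfderiv_clm_comp _
      ((((fr x).contMDiffOn_section t).contMDiffAt
        ((fr x).isOpen_domain.mem_nhds (hfr x))).mdifferentiableAt (by simp)),
      ← (fr x).equiv_cov x (hfr x), (hA x).self_of_nhds.2.1]
    rfl

end GlobalFrame

/-! ### The flat connection of a super tangent bundle. -/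

section SuperTangentConnection

open Bundle

variable {E : Type*} [NormedAddCommGroup E] [NormedSpace ℝ E]
  {M : Type*} [TopologicalSpace M] [ChartedSpace E M] [IsManifold 𝓘(ℝ, E) ∞ M]
  {W : Type*} [NormedAddCommGroup W] [NormedSpace ℝ W]
  {F : M → Type*} [TopologicalSpace (TotalSpace W F)]
  [∀ x, TopologicalSpace (F x)] [FiberBundle W F]
  [∀ x, AddCommGroup (F x)] [∀ x, Module ℝ (F x)] [VectorBundle ℝ W F]

theorem mk_zero_mem_superPart {V₀ V₁ : Type*} [AddCommGroup V₀] [Module ℝ V₀] [AddCommGroup V₁]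
    [Module ℝ V₁] (x : V₀) : (x, (0 : V₁)) ∈ superPart V₀ V₁ 0 := by
  simp [superPart]

theorem zero_mk_mem_superPart {V₀ V₁ : Type*} [AddCommGroup V₀] [Module ℝ V₀] [AddCommGroup V₁]
    [Module ℝ V₁] (y : V₁) : ((0 : V₀), y) ∈ superPart V₀ V₁ 1 := by
  simp [superPart]

namespace SuperTangentBundle

variable (S : SuperTangentBundle E M W F)

theorem bracket_even_odd (U : EvenField E M) (s : OddField E M W F) :
    (S.bracket (U, 0) (0, s)).1 = 0 := by
  have := S.bracket_mem 0 1 _ _ (mk_zero_mem_superPart U) (zero_mk_mem_superPart s)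
  simp only [superPart, zero_add, one_ne_zero, if_false, Submodule.mem_prod,
    Submodule.mem_bot] at this
  exact this.1

theorem bracket_even_even (U V : EvenField E M) : (S.bracket (U, 0) (V, 0)).2 = 0 := by
  have := S.bracket_mem 0 0 _ _ (mk_zero_mem_superPart U) (mk_zero_mem_superPart V)
  simp only [superPart, zero_add, if_true, Submodule.mem_prod, Submodule.mem_bot] at this
  exact this.2

theorem bracket_odd_even (U : EvenField E M) (s : OddField E M W F) :
    S.bracket (U, 0) (0, s) = -S.bracket (0, s) (U, 0) := by
  have := S.bracket_skew 0 1 _ _ (mk_zero_mem_superPart U) (zero_mk_mem_superPart s)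
  simpa using this

/-- The flat connection `∇_U s = [U, s]` of a super tangent bundle. -/
noncomputable def flatConnection : FlatConnection E M W F where
  cov := (S.bracket.compl₁₂ (LinearMap.inl ℝ _ _) (LinearMap.inr ℝ _ _)).compr₂
    (LinearMap.snd ℝ _ _)
  smul_left f U s := by
    have h : ∀ U : EvenField E M, (S.bracket (U, 0) (0, s)).2 = -(S.bracket (0, s) (U, 0)).2 :=
      fun U => by rw [S.bracket_odd_even]; rfl
    ext x
    change (S.bracket (funSMul f U, 0) (0, s)).2 x = f x • (S.bracket (U, 0) (0, s)).2 x
    rw [h, h]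
    -- The function now sits in the second slot, and the derivative term is `0` because the even
    -- part of `(0, s)` is zero.
    have h1 := S.leibniz_odd (0, s) (U, 0) f x
    rw [funSMul_zero] at h1
    change -(S.bracket (0, s) (funSMul f U, 0)).2 x = f x • -(S.bracket (0, s) (U, 0)).2 x
    rw [h1, smul_neg]
    congr 1
    refine (congrArg (· + _) (smul_zero _)).trans (zero_add _)
  leibniz U f s x := by
    have h1 := S.leibniz_odd (U, 0) (0, s) f x
    rw [funSMul_zero] at h1
    exact h1
  flat U V := by
    refine ⟨(S.bracket (U, 0) (V, 0)).1, S.bracket_even U V, fun s => ?_⟩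
    -- With both degrees even the sign is `1`, and the identity reads `∇_U ∇_V s = ∇_[U,V] s + ∇_V
    -- ∇_U s`.
    have h := S.jacobi 0 0 (U, 0) (V, 0) (0, s) (mk_zero_mem_superPart U) (mk_zero_mem_superPart V)
    have h1 : ∀ U : EvenField E M, S.bracket (U, 0) (0, s) = (0, (S.bracket (U, 0) (0, s)).2) :=
      fun U => Prod.ext (S.bracket_even_odd U s) rfl
    have h2 : S.bracket (U, 0) (V, 0) = ((S.bracket (U, 0) (V, 0)).1, 0) :=
      Prod.ext rfl (S.bracket_even_even U V)
    rw [h1 V, h1 U, h2] at h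
    simpa using congrArg Prod.snd h

end SuperTangentBundle

/-- A global parallel frame is a smooth trivialization. -/
def FlatConnection.ParallelFrame.smoothTrivialization {D : FlatConnection E M W F}
    (f : D.ParallelFrame) (hf : f.domain = Set.univ) : SmoothTrivialization E M W F W where
  toDiffeomorph :=
    { toFun := fun z => (z.1, f.equiv z.1 z.2)
      invFun := fun q => ⟨q.1, (f.equiv q.1).symm q.2⟩
      left_inv := fun z => by simp
      right_inv := fun q => by simp
      contMDiff_toFun := by
        have h := f.contMDiffOn
        rw [hf, Set.preimage_univ, contMDiffOn_univ] at h
        exact (contMDiff_proj F).prodMk h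
      contMDiff_invFun := by
        have h := f.contMDiffOn_symm
        rwa [hf, Set.univ_prod_univ, contMDiffOn_univ] at h }
  fiberEquiv := f.equiv
  toDiffeomorph_apply _ _ := rfl

end SuperTangentConnection

theorem mainTheorem2
    {E : Type*} [NormedAddCommGroup E] [NormedSpace ℝ E] [FiniteDimensional ℝ E]
    {M : Type*} [TopologicalSpace M] [T2Space M] [ChartedSpace E M] [IsManifold 𝓘(ℝ, E) ∞ M]
    [SimplyConnectedSpace M]
    {W : Type*} [NormedAddCommGroup W] [NormedSpace ℝ W] [FiniteDimensional ℝ W]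
    {F : M → Type*} [TopologicalSpace (Bundle.TotalSpace W F)]
    [∀ x, TopologicalSpace (F x)] [FiberBundle W F]
    [∀ x, AddCommGroup (F x)] [∀ x, Module ℝ (F x)] [VectorBundle ℝ W F]
    [ContMDiffVectorBundle ∞ W F 𝓘(ℝ, E)]
    (S : SuperTangentBundle E M W F) :
    ∃ φ : SmoothTrivialization E M W F W,
      ∀ (U : EvenField E M) (α : OddField E M W F),
        (S.bracket (U, 0) (0, α)).1 = 0 ∧
        ∀ x : M, φ.toFunction (S.bracket (U, 0) (0, α)).2 x = U.act (φ.toFunction α) x := by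
  obtain ⟨f, hf⟩ := S.flatConnection.exists_parallelFrame_univ
  refine ⟨f.smoothTrivialization hf, fun U α => ⟨S.bracket_even_odd U α, fun x => ?_⟩⟩
  exact f.equiv_cov x (hf ▸ Set.mem_univ x) U α
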